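/- Fix natural numbers $d,k,m,\kappa$. There is a constant $C>0$, depending only on $d,k,m,\kappa$, such that the following holds. Let $n\ge 1$ and $J\le\kappa n$, place $n$ qubits at distinct sites of the lattice $\mathbb Z^d$, and let $$H=\sum_P h_P\,P,\qquad L_j=\sum_P \lambda_{j,P}\,P\quad(1\le j\le J)$$ be geometrically local sums of $n$-qubit Pauli operators $P$, meaning: - every $P$ with $h_P\neq 0$ acts non-trivially only on qubits inside a cube with $k$ lattice sites along each edge (for example, on $k$ adjacent qubits); - for every $j$, the qubits on which $L_j$ acts non-trivially (through some $P$ with $\lambda_{j,P}\ne0$) lie in one such cube, and every qubit is acted on by at most $m$ of the $L_j$; - $h_P\in[-1,1]$, and $\lambda_{j,P}$ is complex with real and imaginary parts in $[-1,1]$ (for example, $\lambda_{j,P}\in[-1,1]$). Put $A=-iH-\sum_{j=1}^J L_j^\dagger L_j$, and let $T>0$, $\epsilon>0$ and $q$ be real. Then there is a quantum circuit on the $n$ qubits and one ancilla qubit, consisting of arbitrary single- and two-qubit unitary gates and of measurements of the ancilla in the computational basis (a run is discarded as soon as an outcome is not $0$), with the following property. For every solution $\psi$ of $\frac{\mathrm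 d}{\mathrm dt}\psi(t)=A\psi(t)$ on $[0,T]$ with $\psi(0)=\psi_0\neq0$ and $\|\psi_0\|/\|\psi(T)\|=q$: 1. if the circuit is started from $|0\rangle\otimes\psi_0$ and all measurement outcomes are $0$, its output is, up to a positive normalization factor, $|0\rangle\otimes\tilde\psi(T)$ with $\|\tilde\psi(T)-\psi(T)\|\le\epsilon\,\|\psi(T)\|$; 2. if the circuit is repeated on fresh copies of the initial state $\psi_0/\|\psi_0\|$ until the first run in which all outcomes are $0$, the expected total number of gates and measurements is at most $$C\left(\frac{q^3n^2T^2}{\epsilon}+q^2n\right).$$ In particular the gate complexity is $\mathcal O(q^3n^2T^2/\epsilon)$ whenever $qnT^2\ge\epsilon$, for instance whenever $T\ge1\ge\epsilon$. The circuit depends on $\psi_0$ only through $q$. The preparation of the copies of $\psi_0$ is not counted. -/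

import Mathlib

open scoped ENNReal Matrix

noncomputable section

/-- Pure states (not necessarily normalized) of qubits labelled by `ι`, with the Hilbert space
norm; computational basis vectors are labelled by bit strings `ι → Fin 2`. -/
abbrev QState (ι : Type) [Fintype ι] := EuclideanSpace ℂ (ι → Fin 2)

/-- Operators on qubits labelled by `ι`, as matrices in the computational basis. -/
abbrev QOp (ι : Type) := Matrix (ι → Fin 2) (ι → Fin 2) ℂ

/-- The operator `M` applied to the state `ψ`. -/
def QOp.app {ι : Type} [Fintype ι] [DecidableEq ι] (M : QOp ι) (ψ : QState ι) : QState ι :=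
  WithLp.toLp 2 (M *ᵥ ψ.ofLp)

/-! ### Pauli sums -/

/-- Labels of the four single-qubit Pauli matrices (including the identity). -/
inductive Pauli where
  | I
  | X
  | Y
  | Z
  deriving DecidableEq

instance : Fintype Pauli :=
  ⟨{.I, .X, .Y, .Z}, fun P => by cases P <;> decide⟩

/-- The single-qubit Pauli matrices. -/
def Pauli.mat : Pauli → Matrix (Fin 2) (Fin 2) ℂ
  | .I => 1
  | .X => !![0, 1; 1, 0]
  | .Y => !![0, -Complex.I; Complex.I, 0]
  | .Z => !![1, 0; 0, -1]

/-- The Pauli operator `⨂ i, P i`. -/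
def pauliOp {ι : Type} [Fintype ι] (P : ι → Pauli) : QOp ι :=
  Matrix.of fun x y => ∏ i, (P i).mat (x i) (y i)

/-- The Pauli sum `∑ P, c P • P`, with one coefficient for each Pauli operator. -/
def pauliSum {ι : Type} [Fintype ι] [DecidableEq ι] (c : (ι → Pauli) → ℂ) : QOp ι :=
  ∑ P : ι → Pauli, c P • pauliOp P

/-- The qubits on which the Pauli operator `P` acts non-trivially. -/
def pauliSupport {ι : Type} (P : ι → Pauli) : Set ι := {i | P i ≠ Pauli.I}

/-- The qubits on which some Pauli operator with non-zero coefficient acts non-trivially. -/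
def sumSupport {ι : Type} (c : (ι → Pauli) → ℂ) : Set ι :=
  {i | ∃ P, c P ≠ 0 ∧ i ∈ pauliSupport P}

/-! ### Geometric locality -/

/-- The qubits in `S`, placed at the sites `pos` of the lattice `ℤ ^ d`, lie in a cube
with `k` lattice sites along each edge. Any `k` lattice sites that are connected by
nearest-neighbour bonds lie in such a cube. -/
def InCube {ι : Type} {d : ℕ} (pos : ι → Fin d → ℤ) (k : ℕ) (S : Set ι) : Prop :=
  ∀ i ∈ S, ∀ j ∈ S, ∀ a : Fin d, |pos i a - pos j a| < (k : ℤ)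

/-- Geometric locality of `H = ∑ P, h P • P` and of the `L j = ∑ P, lam j P • P` for qubits
placed at the sites `pos` of a `d`-dimensional lattice: bounded interaction range `k`, at most
`m` of the operators `L j` acting on any one qubit, and bounded coefficients. -/
structure GeometricallyLocal {n d J : ℕ} (pos : Fin n → Fin d → ℤ) (k m : ℕ)
    (h : (Fin n → Pauli) → ℝ) (lam : Fin J → (Fin n → Pauli) → ℂ) : Prop where
  pos_injective : Function.Injective pos
  ham_local : ∀ P, h P ≠ 0 → InCube pos k (pauliSupport P)
  ham_coeff : ∀ P, h P ∈ Set.Icc (-1 : ℝ) 1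
  jump_local : ∀ j, InCube pos k (sumSupport (lam j))
  jump_overlap : ∀ i : Fin n, Set.ncard {j : Fin J | i ∈ sumSupport (lam j)} ≤ m
  jump_coeff : ∀ j P, (lam j P).re ∈ Set.Icc (-1 : ℝ) 1 ∧ (lam j P).im ∈ Set.Icc (-1 : ℝ) 1

/-! ### The differential equation -/

/-- The coefficient matrix `A = -i H - ∑ j, (L j)† (L j)`. -/
def odeMatrix {n J : ℕ} (h : (Fin n → Pauli) → ℝ) (lam : Fin J → (Fin n → Pauli) → ℂ) :
    QOp (Fin n) :=
  -(Complex.I • pauliSum fun P => (h P : ℂ)) -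
    ∑ j, (pauliSum (lam j))ᴴ * pauliSum (lam j)

/-- `ψ` solves `dψ/dt = A ψ` on `[0, T]`. -/
def IsODESolution {n : ℕ} (A : QOp (Fin n)) (T : ℝ) (ψ : ℝ → QState (Fin n)) : Prop :=
  ∀ t ∈ Set.Icc (0 : ℝ) T, HasDerivWithinAt ψ (A.app (ψ t)) (Set.Icc 0 T) t

/-! ### Circuits with one ancilla qubit and post-selection -/

/-- Instructions on `n + 1` qubits; qubit `0` is the ancilla, the qubits `i.succ` are the
system. An instruction is an arbitrary single-qubit gate, an arbitrary two-qubit gate, or a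
measurement of the ancilla in the computational basis, after which the run is discarded unless
the outcome is `0`. -/
inductive Instr (n : ℕ) where
  | gate1 (a : Fin (n + 1)) (U : Matrix.unitaryGroup (Fin 2) ℂ)
  | gate2 (a b : Fin (n + 1)) (hab : a ≠ b) (U : Matrix.unitaryGroup (Fin 2 × Fin 2) ℂ)
  | measure

/-- The operator that an instruction applies to a run that is not discarded. -/
def Instr.op {n : ℕ} : Instr n → QOp (Fin (n + 1))
  | .gate1 a U => Matrix.of fun x y =>
      if ∀ i, i ≠ a → x i = y i then U.1 (x a) (y a) else 0
  | .gate2 a b _ U => Matrix.of fun x y =>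
      if ∀ i, i ≠ a → i ≠ b → x i = y i then U.1 (x a, x b) (y a, y b) else 0
  | .measure => Matrix.diagonal fun x => if x 0 = 0 then 1 else 0

/-- A circuit is a list of instructions, executed from left to right; its size is the length of
the list, so that measurements are counted along with gates. -/
abbrev Circuit (n : ℕ) := List (Instr n)

/-- The state `|0⟩ ⊗ ψ`. -/
def withAncilla {n : ℕ} (ψ : QState (Fin n)) : QState (Fin (n + 1)) :=
  WithLp.toLp 2 fun x => if x 0 = 0 then ψ (fun i => x i.succ) else 0

/-- The unnormalized state of the successful branch (all measurement outcomes `0`) at the end of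
the circuit, started from `|0⟩ ⊗ ψ₀`. -/
def Circuit.run {n : ℕ} (c : Circuit n) (ψ₀ : QState (Fin n)) : QState (Fin (n + 1)) :=
  c.foldl (fun φ g => g.op.app φ) (withAncilla ψ₀)

/-- The probability that all measurement outcomes are `0`, when the circuit is started from the
normalized state `|0⟩ ⊗ ψ₀ / ‖ψ₀‖`. -/
def Circuit.successProb {n : ℕ} (c : Circuit n) (ψ₀ : QState (Fin n)) : ℝ :=
  ‖c.run ψ₀‖ ^ 2 / ‖ψ₀‖ ^ 2

/-- The expected total number of instructions when the circuit is executed on fresh copies of the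
initial state until the first success: the attempt number `k + 1` takes place with probability
`(1 - p) ^ k`, and every attempt is charged the full size of the circuit. This is `∞` if
`p = 0` and the circuit is not empty. -/
def Circuit.expectedCost {n : ℕ} (c : Circuit n) (ψ₀ : QState (Fin n)) : ℝ≥0∞ :=
  ∑' k : ℕ, (1 - ENNReal.ofReal (c.successProb ψ₀)) ^ k * (c.length : ℝ≥0∞)

end

/-! The matrix `A` is a sum of O(n) local generators: the terms `-i h_P P`, which are
skew-Hermitian, and the `-L_j† L_j`, which are negative semidefinite. All of them, and all their
sums, have a negative semidefinite Hermitian part, so they generate contraction semigroups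
(`isContractive_of_mem_dissipative`). Errors of successive factors therefore add up and are never
amplified, and `q ≥ 1`.

A step of length `δ` is a first-order product formula. A Hamiltonian term is a Pauli rotation,
reduced to two-qubit gates by lowering the weight of the Pauli operator
(`exists_circuit_mat_eq_axisRot`). For a dissipator, let `K = L ⊗ |1⟩⟨0| + L† ⊗ |0⟩⟨1|`. The block
of `exp(-i x K)` between ancilla states `|0⟩` contains only even powers of `x` and begins with `1 -
(x²/2) L†L`; at `x = √(2δ)` it is `1 - δ L†L + O(δ²)`. The exponential is replaced by a symmetric
product of Pauli rotations. This is correct to second order, and its block is still even because `Z`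
on the ancilla anticommutes with every factor's axis. So its cubic error disappears from the block,
and the remaining error is O(x⁴) = O(δ²) (`norm_ancillaBlock_strang_sub_le`). Measuring the ancilla
selects the block.

By locality each generator fails to commute with only O(1) others, so the Lie-Trotter error of a
whole step is O(nδ²) rather than O(n²δ²) (`exists_circuit_step`). With `r` steps of length `T/r` the
total error is O(nT²/r). Taking `r` of order `q n T²/ε` makes the error at most `ε/2 · ‖ψ(T)‖`. For
`ε ≤ 1` the surviving branch then has norm at least `‖ψ(T)‖/2`, so a run succeeds with probability
at least `1/(4q²)`. Multiplying `4q²` by the O(rn) size of one run gives the bound. -/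

section Contractions

/-! ### Products of contractions: errors add up. -/

variable {𝔸 : Type*} [NormedRing 𝔸]

theorem norm_mul_sub_mul_le_of_contractions {V W E F : 𝔸} (hW : ‖W‖ ≤ 1) (hE : ‖E‖ ≤ 1) :
    ‖V * W - E * F‖ ≤ ‖V - E‖ + ‖W - F‖ := by
  have e : V * W - E * F = (V - E) * W + E * (W - F) := by noncomm_ring
  rw [e]
  refine (norm_add_le _ _).trans (add_le_add ?_ ?_)
  · exact (norm_mul_le _ _).trans (mul_le_of_le_one_right (norm_nonneg _) hW)
  · exact (norm_mul_le _ _).trans (mul_le_of_le_one_left (norm_nonneg _) hE)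

theorem norm_pow_le_one_of_contraction {V : 𝔸} (h1 : ‖(1 : 𝔸)‖ ≤ 1) (hV : ‖V‖ ≤ 1) (r : ℕ) :
    ‖V ^ r‖ ≤ 1 := by
  induction r with
  | zero => simpa using h1
  | succ r ih =>
    rw [pow_succ]
    exact (norm_mul_le _ _).trans (mul_le_one₀ ih (norm_nonneg _) hV)

theorem norm_pow_sub_pow_le_of_contractions {V E : 𝔸} (h1 : ‖(1 : 𝔸)‖ ≤ 1) (hV : ‖V‖ ≤ 1)
    (hE : ‖E‖ ≤ 1) (r : ℕ) : ‖V ^ r - E ^ r‖ ≤ r * ‖V - E‖ := by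
  induction r with
  | zero => simp
  | succ r ih =>
    rw [pow_succ, pow_succ]
    refine (norm_mul_sub_mul_le_of_contractions hV
      (norm_pow_le_one_of_contraction h1 hE r)).trans ?_
    push_cast
    linarith

theorem norm_list_prod_le_one {ι : Type*} (V : ι → 𝔸) (h1 : ‖(1 : 𝔸)‖ ≤ 1)
    (hV : ∀ a, ‖V a‖ ≤ 1) (l : List ι) : ‖(l.map V).prod‖ ≤ 1 := by
  induction l with
  | nil => simpa using h1
  | cons a l ih =>
    rw [List.map_cons, List.prod_cons]
    exact (norm_mul_le _ _).trans (mul_le_one₀ (hV a) (norm_nonneg _) ih)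

end Contractions

/-! ### Product formulas for contraction semigroups. -/

section ContractionSemigroups

variable {𝔸 : Type*} [NormedRing 𝔸] [NormedAlgebra ℝ 𝔸] [CompleteSpace 𝔸]

/-- `X` generates a contraction semigroup. -/
def IsContractive (X : 𝔸) : Prop :=
  ∀ t : ℝ, 0 ≤ t → ‖NormedSpace.exp (t • X)‖ ≤ 1

/-- Both sides are the derivative of `exp (t • X)`, which is unique. -/
theorem exp_smul_mul_comm (X : 𝔸) (t : ℝ) :
    NormedSpace.exp (t • X) * X = X * NormedSpace.exp (t • X) :=
  (hasDerivAt_exp_smul_const (𝕂 := ℝ) X t).unique (hasDerivAt_exp_smul_const' (𝕂 := ℝ) X t)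

theorem hasDerivAt_exp_sub_smul (X : 𝔸) (a t : ℝ) :
    HasDerivAt (fun u : ℝ => NormedSpace.exp ((a - u) • X))
      (-(NormedSpace.exp ((a - t) • X) * X)) t := by
  have h := (hasDerivAt_exp_smul_const (𝕂 := ℝ) X (a - t)).scomp t ((hasDerivAt_id t).const_sub a)
  simpa [Function.comp_def] using h

theorem IsContractive.norm_exp_sub_one_le {X : 𝔸} (hX : IsContractive X) {δ : ℝ} (hδ : 0 ≤ δ) :
    ‖NormedSpace.exp (δ • X) - 1‖ ≤ ‖X‖ * δ := by
  have h := norm_image_sub_le_of_norm_deriv_le_segment' (a := 0) (b := δ)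
    (f := fun u : ℝ => NormedSpace.exp (u • X)) (C := ‖X‖)
    (fun x _ => (hasDerivAt_exp_smul_const (𝕂 := ℝ) X x).hasDerivWithinAt)
    (fun x hx => (norm_mul_le _ _).trans
      (mul_le_of_le_one_left (norm_nonneg _) (hX x hx.1))) δ ⟨hδ, le_rfl⟩
  simpa using h

/-- The mean value inequality for `u ↦ exp (u • X) - u • X`. Contractivity removes the usual factor
`exp (δ ‖X‖)`; the sharp factor 1/2 is given up. -/
theorem IsContractive.norm_exp_sub_one_sub_le {X : 𝔸} (hX : IsContractive X) {δ : ℝ}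
    (hδ : 0 ≤ δ) : ‖NormedSpace.exp (δ • X) - (1 + δ • X)‖ ≤ ‖X‖ ^ 2 * δ ^ 2 := by
  have h := norm_image_sub_le_of_norm_deriv_le_segment' (a := 0) (b := δ)
    (f := fun u : ℝ => NormedSpace.exp (u • X) - u • X) (C := ‖X‖ * δ * ‖X‖)
    (fun x _ => ((hasDerivAt_exp_smul_const (𝕂 := ℝ) X x).sub
      ((hasDerivAt_id x).smul_const X)).hasDerivWithinAt)
    (fun x hx => by
      rw [one_smul]
      calc ‖NormedSpace.exp (x • X) * X - X‖ = ‖(NormedSpace.exp (x • X) - 1) * X‖ := by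
            rw [sub_mul, one_mul]
        _ ≤ ‖NormedSpace.exp (x • X) - 1‖ * ‖X‖ := norm_mul_le _ _
        _ ≤ ‖X‖ * δ * ‖X‖ := by
            gcongr
            exact (hX.norm_exp_sub_one_le hx.1).trans (by gcongr; exact hx.2.le)) δ ⟨hδ, le_rfl⟩
  simp only [zero_smul, NormedSpace.exp_zero, sub_zero] at h
  calc _ = ‖NormedSpace.exp (δ • X) - δ • X - 1‖ := by congr 1; abel
    _ ≤ _ := h
    _ = _ := by ring

theorem IsContractive.norm_commutator_exp_le {X : 𝔸} (hX : IsContractive X) (Y : 𝔸) {s : ℝ}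
    (hs : 0 ≤ s) :
    ‖NormedSpace.exp (s • X) * Y - Y * NormedSpace.exp (s • X)‖ ≤ ‖X * Y - Y * X‖ * s := by
  -- The path `exp(uX) Y exp((s-u)X)` joins the two products, and its derivative is the commutator
  -- `[X, Y]` between two contractions.
  have h := norm_image_sub_le_of_norm_deriv_le_segment' (a := 0) (b := s)
    (f := fun u : ℝ => NormedSpace.exp (u • X) * Y * NormedSpace.exp ((s - u) • X))
    (C := ‖X * Y - Y * X‖)
    (fun x _ => (((hasDerivAt_exp_smul_const (𝕂 := ℝ) X x).mul_const Y).mul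
      (hasDerivAt_exp_sub_smul X s x)).hasDerivWithinAt)
    (fun x hx => by
      have e : NormedSpace.exp (x • X) * X * Y * NormedSpace.exp ((s - x) • X) +
          NormedSpace.exp (x • X) * Y * -(NormedSpace.exp ((s - x) • X) * X) =
          NormedSpace.exp (x • X) * (X * Y - Y * X) * NormedSpace.exp ((s - x) • X) := by
        rw [exp_smul_mul_comm X (s - x)]; noncomm_ring
      rw [e]
      refine (norm_mul_le _ _).trans ?_
      refine (mul_le_of_le_one_right (norm_nonneg _) (hX _ (sub_nonneg.2 hx.2.le))).trans ?_
      refine (norm_mul_le _ _).trans (mul_le_of_le_one_left (norm_nonneg _) (hX _ hx.1)))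
    s ⟨hs, le_rfl⟩
  simpa using h

/-- First-order Lie-Trotter error for contraction semigroups. -/
theorem norm_exp_mul_exp_sub_exp_add_le {X Y : 𝔸} (hX : IsContractive X) (hY : IsContractive Y)
    (hXY : IsContractive (X + Y)) {δ : ℝ} (hδ : 0 ≤ δ) :
    ‖NormedSpace.exp (δ • X) * NormedSpace.exp (δ • Y) - NormedSpace.exp (δ • (X + Y))‖ ≤
      ‖X * Y - Y * X‖ * δ ^ 2 := by
  -- The path runs from `exp(δ(X+Y))` to `exp(δX) exp(δY)`. Its derivative contains the commutator
  -- of `exp(uX)` with `Y`, already of size O(u).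
  have h := norm_image_sub_le_of_norm_deriv_le_segment' (a := 0) (b := δ)
    (f := fun u : ℝ => NormedSpace.exp ((δ - u) • (X + Y)) *
      (NormedSpace.exp (u • X) * NormedSpace.exp (u • Y)))
    (C := ‖X * Y - Y * X‖ * δ)
    (fun x _ => ((hasDerivAt_exp_sub_smul (X + Y) δ x).mul
      ((hasDerivAt_exp_smul_const' (𝕂 := ℝ) X x).mul
        (hasDerivAt_exp_smul_const' (𝕂 := ℝ) Y x))).hasDerivWithinAt)
    (fun x hx => by
      have e : -(NormedSpace.exp ((δ - x) • (X + Y)) * (X + Y)) *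
          (NormedSpace.exp (x • X) * NormedSpace.exp (x • Y)) +
          NormedSpace.exp ((δ - x) • (X + Y)) *
          (X * NormedSpace.exp (x • X) * NormedSpace.exp (x • Y) +
            NormedSpace.exp (x • X) * (Y * NormedSpace.exp (x • Y))) =
          NormedSpace.exp ((δ - x) • (X + Y)) *
          (NormedSpace.exp (x • X) * Y - Y * NormedSpace.exp (x • X)) *
            NormedSpace.exp (x • Y) := by
        noncomm_ring
      rw [Pi.mul_apply, e]
      refine (norm_mul_le _ _).trans ?_
      refine (mul_le_of_le_one_right (norm_nonneg _) (hY _ hx.1)).trans ?_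
      refine (norm_mul_le _ _).trans ?_
      refine (mul_le_of_le_one_left (norm_nonneg _) (hXY _ (sub_nonneg.2 hx.2.le))).trans ?_
      refine (hX.norm_commutator_exp_le Y hx.1).trans ?_
      gcongr
      exact hx.2.le)
    δ ⟨hδ, le_rfl⟩
  simp only [sub_self, zero_smul, NormedSpace.exp_zero, one_mul, mul_one, sub_zero] at h
  calc _ ≤ _ := h
    _ = _ := by ring

/-- Error of one step of a first-order product formula whose factors are themselves only
approximated by contractions. -/
theorem norm_list_prod_sub_exp_le {ι : Type*} [Fintype ι] (D : AddSubmonoid 𝔸)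
    (hD : ∀ X ∈ D, IsContractive X) (G V : ι → 𝔸) (hG : ∀ a, G a ∈ D) (hV : ∀ a, ‖V a‖ ≤ 1)
    {δ b g e : ℝ} (hδ : 0 ≤ δ) (hVG : ∀ a, ‖V a - (1 + δ • G a)‖ ≤ b * δ ^ 2)
    (hg : ∀ a, ‖G a‖ ≤ g) (he : ∀ a, ∑ c, ‖G a * G c - G c * G a‖ ≤ e)
    (l : List ι) (hl : l.Nodup) :
    ‖(l.map V).prod - NormedSpace.exp (δ • (l.map G).sum)‖ ≤
      l.length * ((b + g ^ 2 + e) * δ ^ 2) := by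
  have h1 : ‖(1 : 𝔸)‖ ≤ 1 := by
    simpa using hD 0 D.zero_mem 0 le_rfl
  induction l with
  | nil => simp
  | cons a l ih =>
    rw [List.nodup_cons] at hl
    -- Closure of `D` under addition makes every partial sum contractive, as the Trotter bound
    -- requires.
    have hmem : (l.map G).sum ∈ D := D.list_sum_mem (by simp [hG])
    have hc : ‖G a * (l.map G).sum - (l.map G).sum * G a‖ ≤ e := by
      refine le_trans ?_ (he a)
      classical
      -- Without repetitions in the list, the commutator with the tail is a partial sum of the one
      -- bounded by `e`.
      have e1 : (l.map G).sum = ∑ c ∈ l.toFinset, G c := by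
        rw [List.sum_toFinset _ hl.2]
      rw [e1, Finset.mul_sum, Finset.sum_mul, ← Finset.sum_sub_distrib]
      refine (norm_sum_le _ _).trans ?_
      exact Finset.sum_le_sum_of_subset_of_nonneg (Finset.subset_univ _)
        (fun _ _ _ => norm_nonneg _)
    have hVa : ‖V a - NormedSpace.exp (δ • G a)‖ ≤ (b + g ^ 2) * δ ^ 2 := by
      have h2 := (hD _ (hG a)).norm_exp_sub_one_sub_le hδ
      have h3 : ‖G a‖ ^ 2 * δ ^ 2 ≤ g ^ 2 * δ ^ 2 := by
        gcongr
        exact hg a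
      calc ‖V a - NormedSpace.exp (δ • G a)‖
          = ‖(V a - (1 + δ • G a)) - (NormedSpace.exp (δ • G a) - (1 + δ • G a))‖ := by
            congr 1; abel
        _ ≤ ‖V a - (1 + δ • G a)‖ + ‖NormedSpace.exp (δ • G a) - (1 + δ • G a)‖ :=
            norm_sub_le _ _
        _ ≤ (b + g ^ 2) * δ ^ 2 := by linarith [hVG a]
    rw [List.map_cons, List.prod_cons, List.map_cons, List.sum_cons, List.length_cons]
    have h4 := norm_mul_sub_mul_le_of_contractions (V := V a) (W := (l.map V).prod)
      (E := NormedSpace.exp (δ • G a)) (F := NormedSpace.exp (δ • (l.map G).sum))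
      (norm_list_prod_le_one V h1 hV l) (hD _ (hG a) δ hδ)
    have h5 := norm_exp_mul_exp_sub_exp_add_le (hD _ (hG a)) (hD _ hmem)
      (hD _ (D.add_mem (hG a) hmem)) hδ
    have h6 := norm_sub_le_norm_sub_add_norm_sub (V a * (l.map V).prod)
      (NormedSpace.exp (δ • G a) * NormedSpace.exp (δ • (l.map G).sum))
      (NormedSpace.exp (δ • (G a + (l.map G).sum)))
    have h7 : ‖G a * (l.map G).sum - (l.map G).sum * G a‖ * δ ^ 2 ≤ e * δ ^ 2 := by gcongr
    have h8 := ih hl.2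
    push_cast
    linarith

end ContractionSemigroups

/-! ### Rotations about involutions and symmetric products of them. -/

section Rotations

variable {𝔸 : Type*} [Ring 𝔸] [Algebra ℂ 𝔸]

/-- The operator `exp (-i θ Q)` for an involution `Q`. -/
noncomputable def axisRot (θ : ℝ) (Q : 𝔸) : 𝔸 :=
  ((Real.cos θ : ℝ) : ℂ) • (1 : 𝔸) - (Complex.I * (Real.sin θ : ℝ)) • Q

theorem mul_axisRot_of_anticommute {Z Q : 𝔸} (h : Z * Q = -(Q * Z)) (θ : ℝ) :
    Z * axisRot θ Q = axisRot (-θ) Q * Z := by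
  simp only [axisRot, mul_sub, sub_mul, mul_smul_comm, smul_mul_assoc, h, Real.cos_neg,
    Real.sin_neg, mul_one, one_mul]
  push_cast
  module

theorem axisRot_neg_mul_axisRot {Q : 𝔸} (h : Q * Q = 1) (θ : ℝ) :
    axisRot (-θ) Q * axisRot θ Q = 1 := by
  have hI : Complex.I * Complex.I = -1 := Complex.I_mul_I
  have hc : ((Real.cos θ : ℝ) : ℂ) ^ 2 + ((Real.sin θ : ℝ) : ℂ) ^ 2 = 1 := by
    exact_mod_cast Real.cos_sq_add_sin_sq θ
  simp only [axisRot, mul_sub, sub_mul, mul_smul_comm, smul_mul_assoc, h, Real.cos_neg,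
    Real.sin_neg, mul_one, one_mul]
  push_cast at *
  linear_combination (norm := module) (hc) • (1 : 𝔸) - (Complex.sin θ ^ 2 * hI) • (1 : 𝔸)

theorem axisRot_mul_axisRot_neg {Q : 𝔸} (h : Q * Q = 1) (θ : ℝ) :
    axisRot θ Q * axisRot (-θ) Q = 1 := by
  simpa using axisRot_neg_mul_axisRot h (-θ)

/-- Conjugation by a quarter axisRot about `R` maps the involution `Q` to `-i R Q` when `R` and
`Q` anticommute. -/
theorem quarter_axisRot_conj {R Q : 𝔸} (hR : R * R = 1) (h : R * Q = -(Q * R)) (θ : ℝ) :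
    axisRot θ Q = axisRot (-(Real.pi / 4)) R *
      (axisRot θ (-(Complex.I • (R * Q))) * axisRot (Real.pi / 4) R) := by
  have key : axisRot (Real.pi / 4) R * Q = -(Complex.I • (R * Q)) * axisRot (Real.pi / 4) R := by
    have h2 : R * (Q * R) = -Q := by
      rw [← neg_eq_iff_eq_neg.2 h, mul_neg, ← mul_assoc, hR, one_mul]
    simp only [axisRot, mul_sub, sub_mul, mul_smul_comm, smul_mul_assoc, Real.cos_pi_div_four,
      Real.sin_pi_div_four, mul_one, one_mul, mul_assoc, neg_mul, h2]
    have hI : Complex.I * Complex.I = -1 := Complex.I_mul_I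
    linear_combination (norm := module) ((Real.sqrt 2 / 2 : ℝ) * hI) • Q
  have key2 : axisRot (Real.pi / 4) R * axisRot θ Q =
      axisRot θ (-(Complex.I • (R * Q))) * axisRot (Real.pi / 4) R := by
    simp only [axisRot.eq_1 θ, mul_sub, sub_mul, mul_smul_comm, smul_mul_assoc, mul_one, one_mul,
      key]
  rw [← key2, ← mul_assoc, axisRot_neg_mul_axisRot hR, one_mul]

/-- The symmetric product formula for `exp (-i x K)`, where `K` is the sum of the `s • Q` over the
pairs `(s, Q)` in the list. -/
noncomputable def strang : List (ℝ × 𝔸) → ℝ → 𝔸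
  | [], _ => 1
  | p :: l, x => axisRot (x * (p.1 / 2)) p.2 * (strang l x * axisRot (x * (p.1 / 2)) p.2)

/-- Conjugation by `Z` reverses every axis, hence every angle. This is the source of the parity in
`x`. -/
theorem mul_strang_of_anticommute {Z : 𝔸} (l : List (ℝ × 𝔸))
    (h : ∀ p ∈ l, Z * p.2 = -(p.2 * Z)) (x : ℝ) : Z * strang l x = strang l (-x) * Z := by
  induction l with
  | nil => simp [strang]
  | cons p l ih =>
    have ih' := ih fun p hp => h p (List.mem_cons_of_mem _ hp)
    have hp := mul_axisRot_of_anticommute (h p List.mem_cons_self) (x * (p.1 / 2))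
    rw [strang, strang, ← mul_assoc, hp, mul_assoc, ← mul_assoc Z, ih', mul_assoc (strang l (-x)),
      hp, neg_mul]
    simp only [mul_assoc]

end Rotations

/-! ### Third-order expansions with explicit remainders. -/

section TaylorExpansions

variable {𝔸 : Type*} [NormedRing 𝔸] [NormedAlgebra ℂ 𝔸]

/-- A third-order Taylor expansion at `0` on the interval `[-1, 1]`, with the same bound `c` for
all coefficients and for the remainder. -/
structure TaylorBound (f : ℝ → 𝔸) (a₀ a₁ a₂ a₃ : 𝔸) (c : ℝ) : Prop where
  norm₀ : ‖a₀‖ ≤ c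
  norm₁ : ‖a₁‖ ≤ c
  norm₂ : ‖a₂‖ ≤ c
  norm₃ : ‖a₃‖ ≤ c
  rem : ∀ x : ℝ, |x| ≤ 1 →
    ‖f x - (a₀ + (x : ℂ) • a₁ + (x : ℂ) ^ 2 • a₂ + (x : ℂ) ^ 3 • a₃)‖ ≤ c * |x| ^ 4

theorem TaylorBound.congr {f g : ℝ → 𝔸} {a₀ a₁ a₂ a₃ b₀ b₁ b₂ : 𝔸} {c c' : ℝ}
    (hf : TaylorBound f a₀ a₁ a₂ a₃ c) (h : f = g) (h₀ : a₀ = b₀) (h₁ : a₁ = b₁) (h₂ : a₂ = b₂)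
    (hc : c = c') : TaylorBound g b₀ b₁ b₂ a₃ c' := by
  subst h h₀ h₁ h₂ hc
  exact hf

theorem TaylorBound.norm_poly_le {f : ℝ → 𝔸} {a₀ a₁ a₂ a₃ : 𝔸} {c : ℝ}
    (hf : TaylorBound f a₀ a₁ a₂ a₃ c) {x : ℝ} (hx : |x| ≤ 1) :
    ‖a₀ + (x : ℂ) • a₁ + (x : ℂ) ^ 2 • a₂ + (x : ℂ) ^ 3 • a₃‖ ≤ 4 * c := by
  have aux : ∀ (k : ℕ) (a : 𝔸), ‖a‖ ≤ c → ‖(x : ℂ) ^ k • a‖ ≤ c := fun k a ha => by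
    rw [norm_smul, norm_pow, Complex.norm_real, Real.norm_eq_abs]
    exact (mul_le_of_le_one_left (norm_nonneg _) (pow_le_one₀ (abs_nonneg _) hx)).trans ha
  have h1 := aux 1 a₁ hf.norm₁
  rw [pow_one] at h1
  refine (norm_add₄_le).trans ?_
  linarith [hf.norm₀, aux 2 a₂ hf.norm₂, aux 3 a₃ hf.norm₃]

/-- Coefficients multiply as truncated power series. The remainder collects 1 + 4 + 4 + 6 = 15
multiples of `c c' |x|⁴`, rounded up to 16. -/
theorem TaylorBound.mul {f g : ℝ → 𝔸} {a₀ a₁ a₂ a₃ b₀ b₁ b₂ b₃ : 𝔸} {c c' : ℝ}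
    (hf : TaylorBound f a₀ a₁ a₂ a₃ c) (hg : TaylorBound g b₀ b₁ b₂ b₃ c') :
    TaylorBound (fun x => f x * g x) (a₀ * b₀) (a₀ * b₁ + a₁ * b₀)
      (a₀ * b₂ + a₁ * b₁ + a₂ * b₀) (a₀ * b₃ + a₁ * b₂ + a₂ * b₁ + a₃ * b₀) (16 * c * c') := by
  have hc : 0 ≤ c := (norm_nonneg _).trans hf.norm₀
  have hc' : 0 ≤ c' := (norm_nonneg _).trans hg.norm₀
  have hcc : 0 ≤ c * c' := mul_nonneg hc hc'
  have aux : ∀ {a b : 𝔸}, ‖a‖ ≤ c → ‖b‖ ≤ c' → ‖a * b‖ ≤ c * c' := fun {a b} ha hb =>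
    (norm_mul_le _ _).trans (mul_le_mul ha hb (norm_nonneg _) hc)
  obtain ⟨f0, f1, f2, f3, fr⟩ := id hf
  obtain ⟨g0, g1, g2, g3, gr⟩ := id hg
  refine ⟨?_, ?_, ?_, ?_, fun x hx => ?_⟩
  · linarith [aux f0 g0]
  · linarith [norm_add_le (a₀ * b₁) (a₁ * b₀), aux f0 g1, aux f1 g0]
  · linarith [norm_add₃_le (a := a₀ * b₂) (b := a₁ * b₁) (c := a₂ * b₀), aux f0 g2, aux f1 g1,
      aux f2 g0]
  · linarith [norm_add₄_le (a := a₀ * b₃) (b := a₁ * b₂) (c := a₂ * b₁) (d := a₃ * b₀),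
      aux f0 g3, aux f1 g2, aux f2 g1, aux f3 g0]
  · have hp := hf.norm_poly_le hx
    have hq := hg.norm_poly_le hx
    have fr := fr x hx
    have gr := gr x hx
    set p := a₀ + (x : ℂ) • a₁ + (x : ℂ) ^ 2 • a₂ + (x : ℂ) ^ 3 • a₃ with hpdef
    set q := b₀ + (x : ℂ) • b₁ + (x : ℂ) ^ 2 • b₂ + (x : ℂ) ^ 3 • b₃ with hqdef
    have e : f x * g x - (a₀ * b₀ + (x : ℂ) • (a₀ * b₁ + a₁ * b₀) +
        (x : ℂ) ^ 2 • (a₀ * b₂ + a₁ * b₁ + a₂ * b₀) +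
        (x : ℂ) ^ 3 • (a₀ * b₃ + a₁ * b₂ + a₂ * b₁ + a₃ * b₀)) =
        (f x - p) * (g x - q) + (f x - p) * q + p * (g x - q) +
        (x : ℂ) ^ 4 • ((a₁ * b₃ + a₂ * b₂ + a₃ * b₁) +
          (x : ℂ) • (a₂ * b₃ + a₃ * b₂) + (x : ℂ) ^ 2 • (a₃ * b₃)) := by
      have e1 : f x * g x = (f x - p) * (g x - q) + (f x - p) * q + p * (g x - q) + p * q := by
        noncomm_ring
      rw [e1, add_sub_assoc]
      congr 1
      rw [hpdef, hqdef]
      simp only [mul_add, add_mul, smul_mul_assoc, mul_smul_comm, smul_smul,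
        smul_add]
      module
    rw [e]
    have hx4 : |x| ^ 4 ≤ 1 := pow_le_one₀ (abs_nonneg _) hx
    have hx4' : 0 ≤ |x| ^ 4 := by positivity
    have t1 : ‖(f x - p) * (g x - q)‖ ≤ c * c' * |x| ^ 4 := by
      refine (norm_mul_le _ _).trans ?_
      calc _ ≤ (c * |x| ^ 4) * (c' * 1) := by
            refine mul_le_mul fr (gr.trans ?_) (norm_nonneg _) (by positivity)
            gcongr
        _ = _ := by ring
    have t2 : ‖(f x - p) * q‖ ≤ 4 * (c * c' * |x| ^ 4) := by
      refine (norm_mul_le _ _).trans ?_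
      calc _ ≤ (c * |x| ^ 4) * (4 * c') := mul_le_mul fr hq (norm_nonneg _) (by positivity)
        _ = _ := by ring
    have t3 : ‖p * (g x - q)‖ ≤ 4 * (c * c' * |x| ^ 4) := by
      refine (norm_mul_le _ _).trans ?_
      calc _ ≤ (4 * c) * (c' * |x| ^ 4) := mul_le_mul hp gr (norm_nonneg _) (by positivity)
        _ = _ := by ring
    have aux2 : ∀ (k : ℕ) (a : 𝔸), ‖(x : ℂ) ^ k • a‖ ≤ ‖a‖ := fun k a => by
      rw [norm_smul, norm_pow, Complex.norm_real, Real.norm_eq_abs]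
      exact mul_le_of_le_one_left (norm_nonneg _) (pow_le_one₀ (abs_nonneg _) hx)
    have t4 : ‖(a₁ * b₃ + a₂ * b₂ + a₃ * b₁) + (x : ℂ) • (a₂ * b₃ + a₃ * b₂) +
        (x : ℂ) ^ 2 • (a₃ * b₃)‖ ≤ 6 * (c * c') := by
      have h1 := aux2 1 (a₂ * b₃ + a₃ * b₂)
      rw [pow_one] at h1
      refine norm_add₃_le.trans ?_
      linarith [norm_add₃_le (a := a₁ * b₃) (b := a₂ * b₂) (c := a₃ * b₁), aux f1 g3, aux f2 g2,
        aux f3 g1, norm_add_le (a₂ * b₃) (a₃ * b₂), aux f2 g3, aux f3 g2, aux2 2 (a₃ * b₃),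
        aux f3 g3]
    have t5 : ‖(x : ℂ) ^ 4 • ((a₁ * b₃ + a₂ * b₂ + a₃ * b₁) + (x : ℂ) • (a₂ * b₃ + a₃ * b₂) +
        (x : ℂ) ^ 2 • (a₃ * b₃))‖ ≤ 6 * (c * c' * |x| ^ 4) := by
      rw [norm_smul, norm_pow, Complex.norm_real, Real.norm_eq_abs]
      calc _ ≤ |x| ^ 4 * (6 * (c * c')) := by gcongr
        _ = _ := by ring
    refine norm_add₄_le.trans ?_
    have : 0 ≤ c * c' * |x| ^ 4 := by positivity
    linarith

theorem taylorBound_axisRot (h1 : ‖(1 : 𝔸)‖ ≤ 1) {Q : 𝔸} (hQ : ‖Q‖ ≤ 1) {s : ℝ} (hs : |s| ≤ 1) :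
    TaylorBound (fun x => axisRot (x * s) Q) 1 (-(Complex.I * s) • Q)
      (-((s : ℂ) ^ 2 / 2) • (1 : 𝔸)) ((Complex.I * (s : ℂ) ^ 3 / 6) • Q) 1 := by
  have hs' : ∀ k : ℕ, |s| ^ k ≤ 1 := fun k => pow_le_one₀ (abs_nonneg _) hs
  refine ⟨h1, ?_, ?_, ?_, fun x hx => ?_⟩
  · rw [norm_smul]
    refine mul_le_one₀ ?_ (norm_nonneg _) hQ
    simpa using hs
  · rw [norm_smul]
    refine mul_le_one₀ ?_ (norm_nonneg _) h1
    have := hs' 2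
    simp
    linarith [sq_abs s]
  · rw [norm_smul]
    refine mul_le_one₀ ?_ (norm_nonneg _) hQ
    have := hs' 3
    simp
    linarith
  · have hxs : |x * s| ≤ 1 := by
      rw [abs_mul]; exact mul_le_one₀ hx (abs_nonneg _) hs
    have hxs4 : |x * s| ^ 4 ≤ |x| ^ 4 := by
      rw [abs_mul, mul_pow]
      exact mul_le_of_le_one_right (by positivity) (hs' 4)
    have hxs5 : |x * s| ^ 5 ≤ |x| ^ 4 :=
      (pow_le_pow_of_le_one (abs_nonneg _) hxs (by norm_num)).trans hxs4
    have hc := Real.cos_bound hxs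
    have hsn := Real.sin_bound hxs
    have e : axisRot (x * s) Q - (1 + (x : ℂ) • (-(Complex.I * s) • Q) +
        (x : ℂ) ^ 2 • (-((s : ℂ) ^ 2 / 2) • (1 : 𝔸)) +
        (x : ℂ) ^ 3 • ((Complex.I * (s : ℂ) ^ 3 / 6) • Q)) =
        ((Real.cos (x * s) - (1 - (x * s) ^ 2 / 2) : ℝ) : ℂ) • (1 : 𝔸) -
        (Complex.I * ((Real.sin (x * s) - (x * s - (x * s) ^ 3 / 6) : ℝ) : ℂ)) • Q := by
      rw [axisRot]
      push_cast
      module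
    rw [e]
    refine (norm_sub_le _ _).trans ?_
    rw [norm_smul, norm_smul, norm_mul, Complex.norm_I, one_mul, Complex.norm_real,
      Complex.norm_real, Real.norm_eq_abs, Real.norm_eq_abs]
    have k1 := mul_le_of_le_one_right (abs_nonneg (Real.cos (x * s) - (1 - (x * s) ^ 2 / 2))) h1
    have k2 := mul_le_of_le_one_right
      (abs_nonneg (Real.sin (x * s) - (x * s - (x * s) ^ 3 / 6))) hQ
    have : 0 ≤ |x| ^ 4 := by positivity
    linarith

/-- The symmetric product formula agrees with `exp (-i x K)` up to second order. -/
theorem exists_taylorBound_strang (h1 : ‖(1 : 𝔸)‖ ≤ 1) (l : List (ℝ × 𝔸))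
    (hs : ∀ p ∈ l, |p.1| ≤ 1) (hQ : ∀ p ∈ l, ‖p.2‖ ≤ 1) (hQQ : ∀ p ∈ l, p.2 * p.2 = 1) :
    ∃ T : 𝔸, TaylorBound (strang l) 1
      (-Complex.I • (l.map fun p => (p.1 : ℂ) • p.2).sum)
      (-(1 / 2 : ℂ) • ((l.map fun p => (p.1 : ℂ) • p.2).sum *
        (l.map fun p => (p.1 : ℂ) • p.2).sum)) T (256 ^ l.length) := by
  induction l with
  | nil =>
    refine ⟨0, ?_, ?_, ?_, ?_, fun x hx => ?_⟩ <;> simp [strang, h1]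
  | cons p l ih =>
    obtain ⟨T, hT⟩ := ih (fun q hq => hs q (List.mem_cons_of_mem _ hq))
      (fun q hq => hQ q (List.mem_cons_of_mem _ hq))
      (fun q hq => hQQ q (List.mem_cons_of_mem _ hq))
    have hp : |p.1 / 2| ≤ 1 := by
      have := hs p List.mem_cons_self
      rw [abs_div, abs_two]
      linarith
    have hr := taylorBound_axisRot h1 (hQ p List.mem_cons_self) hp
    -- Two products cost a factor 16² = 256 per term. The cubic coefficient stays unspecified, since
    -- parity will remove it.
    have hm := hr.mul (hT.mul hr)
    have hQp := hQQ p List.mem_cons_self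
    refine ⟨_, hm.congr rfl ?_ ?_ ?_ ?_⟩
    · simp
    · simp only [List.map_cons, List.sum_cons, one_mul, mul_one]
      push_cast
      module
    -- The symmetric splitting gives the two orderings of each mixed product equal coefficients, so
    -- the quadratic term is a true square.
    · simp only [List.map_cons, List.sum_cons, one_mul, mul_one, mul_add, add_mul,
        smul_mul_assoc, mul_smul_comm, smul_smul, smul_add, hQp]
      push_cast
      have hI : Complex.I * Complex.I = -1 := Complex.I_mul_I
      have hI2 : Complex.I ^ 2 = -1 := Complex.I_sq
      match_scalars <;> ring_nf <;> simp only [hI2] <;> ring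
    · rw [List.length_cons, pow_succ]; ring

end TaylorExpansions

/-! ### Tensor products of single-qubit matrices. -/

section Tensors

variable {ι : Type} [Fintype ι]

/-- The operator `⨂ i, A i`. -/
def tensorOp (A : ι → Matrix (Fin 2) (Fin 2) ℂ) : QOp ι :=
  Matrix.of fun x y => ∏ i, A i (x i) (y i)

theorem pauliOp_eq_tensorOp (P : ι → Pauli) : pauliOp P = tensorOp fun i => (P i).mat := rfl

theorem tensorOp_mul [DecidableEq ι] (A B : ι → Matrix (Fin 2) (Fin 2) ℂ) :
    tensorOp A * tensorOp B = tensorOp fun i => A i * B i := by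
  ext x y
  simp only [tensorOp, Matrix.mul_apply, Matrix.of_apply, ← Finset.prod_mul_distrib]
  rw [Finset.prod_univ_sum, Fintype.piFinset_univ]

theorem tensorOp_one [DecidableEq ι] :
    tensorOp (fun _ : ι => (1 : Matrix (Fin 2) (Fin 2) ℂ)) = 1 := by
  ext x y
  simp only [tensorOp, Matrix.of_apply, Matrix.one_apply, Finset.prod_ite_zero,
    Finset.prod_const_one, Finset.mem_univ, forall_const, funext_iff]

theorem tensorOp_smul (c : ι → ℂ) (A : ι → Matrix (Fin 2) (Fin 2) ℂ) :
    (tensorOp fun i => c i • A i) = (∏ i, c i) • tensorOp A := by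
  ext x y
  simp [tensorOp, Finset.prod_mul_distrib]

theorem tensorOp_conjTranspose (A : ι → Matrix (Fin 2) (Fin 2) ℂ) :
    (tensorOp A)ᴴ = tensorOp fun i => (A i)ᴴ := by
  ext x y
  simp [tensorOp, Matrix.conjTranspose_apply]

end Tensors

/-! ### Algebra of Pauli operators. -/

section Paulis

theorem Pauli.mat_conjTranspose (P : Pauli) : P.matᴴ = P.mat := by
  cases P <;> ext i j <;> fin_cases i <;> fin_cases j <;>
    simp [Pauli.mat, Matrix.conjTranspose_apply]

theorem Pauli.mat_mul_self (P : Pauli) : P.mat * P.mat = 1 := by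
  cases P <;> ext i j <;> fin_cases i <;> fin_cases j <;>
    simp [Pauli.mat, Matrix.mul_apply, Fin.sum_univ_two]

/-- Supplies the axis of the quarter rotation that lowers the weight of a Pauli operator. -/
theorem Pauli.exists_anticommute {P : Pauli} (hP : P ≠ .I) :
    ∃ R S : Pauli, R.mat * P.mat = Complex.I • S.mat ∧ R.mat * P.mat = -(P.mat * R.mat) := by
  cases P
  · exact absurd rfl hP
  · refine ⟨.Z, .Y, ?_, ?_⟩ <;> ext i j <;> fin_cases i <;> fin_cases j <;>
      simp [Pauli.mat, Matrix.mul_apply, Fin.sum_univ_two]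
  · refine ⟨.X, .Z, ?_, ?_⟩ <;> ext i j <;> fin_cases i <;> fin_cases j <;>
      simp [Pauli.mat, Matrix.mul_apply, Fin.sum_univ_two]
  · refine ⟨.Y, .X, ?_, ?_⟩ <;> ext i j <;> fin_cases i <;> fin_cases j <;>
      simp [Pauli.mat, Matrix.mul_apply, Fin.sum_univ_two]

variable {ι : Type} [Fintype ι]

theorem pauliOp_conjTranspose (P : ι → Pauli) : (pauliOp P)ᴴ = pauliOp P := by
  simp [pauliOp_eq_tensorOp, tensorOp_conjTranspose, Pauli.mat_conjTranspose]

variable [DecidableEq ι]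

theorem pauliOp_mul_self (P : ι → Pauli) : pauliOp P * pauliOp P = 1 := by
  simp [pauliOp_eq_tensorOp, tensorOp_mul, Pauli.mat_mul_self, tensorOp_one]

theorem pauliOp_commute {P Q : ι → Pauli} (h : ∀ i, P i = .I ∨ Q i = .I) :
    Commute (pauliOp P) (pauliOp Q) := by
  rw [commute_iff_eq]
  simp only [pauliOp_eq_tensorOp, tensorOp_mul]
  congr 1
  funext i
  rcases h i with h | h <;> simp [h, Pauli.mat]

theorem axisRot_mem_unitary {𝔸 : Type*} [Ring 𝔸] [StarRing 𝔸] [Algebra ℂ 𝔸] [StarModule ℂ 𝔸]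
    {Q : 𝔸} (hQ : star Q = Q) (h : Q * Q = 1) (θ : ℝ) : axisRot θ Q ∈ unitary 𝔸 := by
  have hs : star (axisRot θ Q) = axisRot (-θ) Q := by
    simp only [axisRot, star_sub, star_smul, star_one, hQ, Real.cos_neg, Real.sin_neg, star_mul',
      Complex.star_def, Complex.conj_ofReal, Complex.conj_I]
    push_cast
    module
  rw [Unitary.mem_iff, hs]
  exact ⟨axisRot_neg_mul_axisRot h θ, axisRot_mul_axisRot_neg h θ⟩

theorem axisRot_pauliOp_mem_unitary (P : ι → Pauli) (θ : ℝ) :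
    axisRot θ (pauliOp P) ∈ unitary (QOp ι) :=
  axisRot_mem_unitary (by rw [Matrix.star_eq_conjTranspose, pauliOp_conjTranspose])
    (pauliOp_mul_self P) θ

open Kronecker in
theorem kronecker_pauli_mul_self (P Q : Pauli) : (P.mat ⊗ₖ Q.mat) * (P.mat ⊗ₖ Q.mat) = 1 := by
  rw [← Matrix.mul_kronecker_mul, Pauli.mat_mul_self, Pauli.mat_mul_self, Matrix.one_kronecker_one]

open Kronecker in
theorem kronecker_pauli_star (P Q : Pauli) : star (P.mat ⊗ₖ Q.mat) = P.mat ⊗ₖ Q.mat := by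
  rw [Matrix.star_eq_conjTranspose, Matrix.conjTranspose_kronecker, Pauli.mat_conjTranspose,
    Pauli.mat_conjTranspose]

end Paulis

/-! ### Compiling Pauli rotations into two-qubit gates. -/

section Circuits

variable {n : ℕ}

/-- The operator that a circuit applies to a run that is not discarded. -/
noncomputable def Circuit.mat : Circuit n → QOp (Fin (n + 1))
  | [] => 1
  | g :: c => Circuit.mat c * g.op

theorem Circuit.mat_append (c d : Circuit n) :
    Circuit.mat (c ++ d) = Circuit.mat d * Circuit.mat c := by
  induction c with
  | nil => simp [Circuit.mat]
  | cons g c ih => rw [List.cons_append, Circuit.mat, ih, Circuit.mat, mul_assoc]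

theorem Circuit.mat_singleton (g : Instr n) : Circuit.mat [g] = g.op := by
  simp [Circuit.mat]

theorem QOp.app_app {ι : Type} [Fintype ι] [DecidableEq ι] (M N : QOp ι) (ψ : QState ι) :
    M.app (N.app ψ) = QOp.app (M * N) ψ := by
  simp [QOp.app, Matrix.mulVec_mulVec]

theorem Circuit.run_eq (c : Circuit n) (ψ : QState (Fin n)) :
    c.run ψ = (Circuit.mat c).app (withAncilla ψ) := by
  unfold Circuit.run
  generalize withAncilla ψ = φ
  induction c generalizing φ with
  | nil => simp [Circuit.mat, QOp.app]
  | cons g c ih => rw [List.foldl_cons, ih, QOp.app_app, Circuit.mat]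

open Kronecker in
theorem exists_gate2_op_eq_axisRot {a b : Fin (n + 1)} (hab : a ≠ b) (θ : ℝ)
    {P : Fin (n + 1) → Pauli} (hP : ∀ i, i ≠ a → i ≠ b → P i = .I) :
    ∃ g : Instr n, g.op = axisRot θ (pauliOp P) := by
  refine ⟨.gate2 a b hab ⟨axisRot θ ((P a).mat ⊗ₖ (P b).mat),
    axisRot_mem_unitary (kronecker_pauli_star _ _) (kronecker_pauli_mul_self _ _) θ⟩, ?_⟩
  ext x y
  simp only [Instr.op, Matrix.of_apply, axisRot, Matrix.sub_apply, Matrix.smul_apply, pauliOp,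
    Matrix.kroneckerMap_apply]
  split_ifs with h
  · have h1 : (1 : Matrix (Fin 2 × Fin 2) (Fin 2 × Fin 2) ℂ) (x a, x b) (y a, y b) =
        (1 : QOp (Fin (n + 1))) x y := by
      simp only [Matrix.one_apply]
      congr 1
      rw [Prod.mk.injEq, funext_iff, eq_iff_iff]
      refine ⟨fun hh i => ?_, fun hh => ⟨hh a, hh b⟩⟩
      by_cases hia : i = a
      · rw [hia]; exact hh.1
      by_cases hib : i = b
      · rw [hib]; exact hh.2
      exact h i hia hib
    have h2 : ∏ i, (P i).mat (x i) (y i) =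
        (P a).mat (x a) (y a) * (P b).mat (x b) (y b) := by
      rw [← Finset.prod_pair hab (f := fun i => (P i).mat (x i) (y i))]
      symm
      refine Finset.prod_subset (Finset.subset_univ _) fun i _ hi => ?_
      simp only [Finset.mem_insert, Finset.mem_singleton, not_or] at hi
      rw [hP i hi.1 hi.2, h i hi.1 hi.2]
      simp [Pauli.mat]
    rw [h1, h2]
  · push Not at h
    obtain ⟨i, hia, hib, hi⟩ := h
    have h1 : (1 : QOp (Fin (n + 1))) x y = 0 :=
      Matrix.one_apply_ne fun hxy => hi (congrFun hxy i)
    have h2 : ∏ i, (P i).mat (x i) (y i) = 0 := by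
      refine Finset.prod_eq_zero (Finset.mem_univ i) ?_
      rw [hP i hia hib]
      exact Matrix.one_apply_ne hi
    rw [h1, h2]
    simp

/-- A rotation about a Pauli operator of weight at most `w + 1` takes `2 w + 1` two-qubit
gates. -/
theorem exists_circuit_mat_eq_axisRot (hn : 1 ≤ n) (w : ℕ) (θ : ℝ) (P : Fin (n + 1) → Pauli)
    (hP : (Finset.univ.filter fun i => P i ≠ .I).card ≤ w + 1) :
    ∃ c : Circuit n, Circuit.mat c = axisRot θ (pauliOp P) ∧ c.length ≤ 2 * w + 1 := by
  have small : ∀ P : Fin (n + 1) → Pauli, (Finset.univ.filter fun i => P i ≠ .I).card ≤ 1 →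
      ∃ c : Circuit n, Circuit.mat c = axisRot θ (pauliOp P) ∧ c.length ≤ 1 := by
    intro P hP
    -- Weight at most one also uses a two-qubit gate, with an arbitrary second qubit; `n ≥ 1`
    -- provides one.
    have : Nontrivial (Fin (n + 1)) := Fin.nontrivial_iff_two_le.2 (by omega)
    obtain ⟨a, ha⟩ := (Finset.card_le_one_iff_subset_singleton (s := _)).1 hP
    obtain ⟨b, hb⟩ := exists_ne a
    obtain ⟨g, hg⟩ := exists_gate2_op_eq_axisRot hb.symm θ (P := P) fun i hia _ => by
      by_contra hi
      exact hia (Finset.mem_singleton.1 (ha (by simpa using hi)))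
    exact ⟨[g], by rw [Circuit.mat_singleton, hg], by simp⟩
  induction w generalizing P with
  | zero => exact small P hP
  | succ w ih =>
    by_cases h1 : (Finset.univ.filter fun i => P i ≠ .I).card ≤ 1
    · obtain ⟨c, hc, hl⟩ := small P h1
      exact ⟨c, hc, by omega⟩
    · obtain ⟨a, ha, b, hb, hab⟩ := Finset.one_lt_card.1 (not_le.1 h1)
      simp only [Finset.mem_filter, Finset.mem_univ, true_and] at ha hb
      obtain ⟨B, C, hBC, hB⟩ := Pauli.exists_anticommute ha
      -- `R` acts on two qubits only and repeats `P` at `b`. Hence `-i R P` is, up to no further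
      -- phase, the Pauli operator `P'`, trivial at `b`: conjugation by two gates lowers the weight
      -- by one.
      let R : Fin (n + 1) → Pauli := fun i => if i = a then B else if i = b then P b else .I
      let P' : Fin (n + 1) → Pauli := fun i => if i = a then C else if i = b then .I else P i
      have hR : ∀ i, i ≠ a → i ≠ b → R i = .I := fun i hia hib => by simp [R, hia, hib]
      have e1 : pauliOp R * pauliOp P = Complex.I • pauliOp P' := by
        have e : (fun i => (R i).mat * (P i).mat) =
            fun i => (if i = a then Complex.I else 1 : ℂ) • (P' i).mat := by
          funext i
          by_cases hia : i = a
          · simp [R, P', hia, hBC]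
          by_cases hib : i = b
          · subst hib
            simp only [R, P', hia, if_false, if_true, Pauli.mat_mul_self, one_smul]
            rfl
          · simp [R, P', hia, hib, Pauli.mat]
        rw [pauliOp_eq_tensorOp, pauliOp_eq_tensorOp, tensorOp_mul, e, tensorOp_smul,
          Finset.prod_ite_eq' Finset.univ a fun _ => Complex.I, if_pos (Finset.mem_univ _),
          pauliOp_eq_tensorOp]
      have e2 : pauliOp R * pauliOp P = -(pauliOp P * pauliOp R) := by
        have e : (fun i => (R i).mat * (P i).mat) =
            fun i => (if i = a then -1 else 1 : ℂ) • ((P i).mat * (R i).mat) := by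
          funext i
          by_cases hia : i = a
          · simp [R, hia, hB]
          by_cases hib : i = b
          · have hba : b ≠ a := hab.symm
            simp [R, hib, hba]
          · simp [R, hia, hib, Pauli.mat]
        rw [pauliOp_eq_tensorOp, pauliOp_eq_tensorOp, tensorOp_mul, tensorOp_mul, e, tensorOp_smul,
          Finset.prod_ite_eq' Finset.univ a fun _ => (-1 : ℂ), if_pos (Finset.mem_univ _),
          neg_one_smul]
      have e3 : -(Complex.I • (pauliOp R * pauliOp P)) = pauliOp P' := by
        rw [e1, smul_smul, Complex.I_mul_I, neg_one_smul, neg_neg]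
      obtain ⟨c, hc, hl⟩ := ih P' (by
        have hsub : (Finset.univ.filter fun i => P' i ≠ .I) ⊆
            (Finset.univ.filter fun i => P i ≠ .I).erase b := by
          intro i hi
          simp only [Finset.mem_filter, Finset.mem_univ, true_and, P'] at hi
          simp only [Finset.mem_erase, Finset.mem_filter, Finset.mem_univ, true_and]
          by_cases hia : i = a
          · subst hia
            exact ⟨hab, ha⟩
          by_cases hib : i = b
          · rw [if_neg hia, if_pos hib] at hi
            exact absurd rfl hi
          · exact ⟨hib, by simpa [hia, hib] using hi⟩
        have := Finset.card_le_card hsub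
        rw [Finset.card_erase_of_mem (by simpa using hb)] at this
        omega)
      obtain ⟨g, hg⟩ := exists_gate2_op_eq_axisRot hab (Real.pi / 4) hR
      obtain ⟨g', hg'⟩ := exists_gate2_op_eq_axisRot hab (-(Real.pi / 4)) hR
      refine ⟨[g] ++ c ++ [g'], ?_, ?_⟩
      · rw [Circuit.mat_append, Circuit.mat_append, Circuit.mat_singleton, Circuit.mat_singleton,
          hg, hg', hc, quarter_axisRot_conj (pauliOp_mul_self R) e2 θ, e3]
      · simp only [List.length_append, List.length_singleton]
        omega

theorem exists_circuit_mat_eq_strang (hn : 1 ≤ n) (w : ℕ) (x : ℝ)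
    (l : List (ℝ × (Fin (n + 1) → Pauli)))
    (hl : ∀ p ∈ l, (Finset.univ.filter fun i => p.2 i ≠ .I).card ≤ w + 1) :
    ∃ c : Circuit n, Circuit.mat c = strang (l.map fun p => (p.1, pauliOp p.2)) x ∧
      c.length ≤ l.length * (2 * (2 * w + 1)) := by
  induction l with
  | nil => exact ⟨[], by simp [Circuit.mat, strang]⟩
  | cons p l ih =>
    obtain ⟨c, hc, hcl⟩ := ih fun q hq => hl q (List.mem_cons_of_mem _ hq)
    obtain ⟨d, hd, hdl⟩ := exists_circuit_mat_eq_axisRot hn w (x * (p.1 / 2)) p.2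
      (hl p List.mem_cons_self)
    refine ⟨d ++ c ++ d, ?_, ?_⟩
    · rw [Circuit.mat_append, Circuit.mat_append, hc, hd, List.map_cons, strang]
    · simp only [List.length_append, List.length_cons]
      rw [add_mul]
      omega

end Circuits

/-! ### Dissipative operators and the solution of the differential equation. -/

section Dissipative

open scoped Matrix.Norms.L2Operator

variable {ι : Type} [Fintype ι] [DecidableEq ι]

theorem QOp.app_eq_toEuclideanCLM (M : QOp ι) (v : QState ι) :
    M.app v = Matrix.toEuclideanCLM (𝕜 := ℂ) M v := rfl

theorem QOp.norm_app_le (M : QOp ι) (v : QState ι) : ‖M.app v‖ ≤ ‖M‖ * ‖v‖ :=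
  Matrix.l2_opNorm_mulVec M v

theorem QOp.norm_le_one {M : QOp ι} (h : ∀ v, ‖M.app v‖ ≤ ‖v‖) : ‖M‖ ≤ 1 := by
  rw [Matrix.cstar_norm_def]
  exact ContinuousLinearMap.opNorm_le_bound _ zero_le_one fun v => by
    simpa [QOp.app_eq_toEuclideanCLM] using h v

theorem QOp.sub_app (M N : QOp ι) (v : QState ι) :
    QOp.app (M - N) v = M.app v - N.app v := by
  simp [QOp.app_eq_toEuclideanCLM]

theorem QOp.neg_app (M : QOp ι) (v : QState ι) : QOp.app (-M) v = -M.app v := by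
  simp [QOp.app_eq_toEuclideanCLM]

theorem QOp.one_app (v : QState ι) : QOp.app (1 : QOp ι) v = v := by
  simp [QOp.app_eq_toEuclideanCLM]

theorem QOp.inner_app (M : QOp ι) (v w : QState ι) :
    inner ℂ v (M.app w) = inner ℂ (QOp.app Mᴴ v) w := by
  rw [QOp.app_eq_toEuclideanCLM, QOp.app_eq_toEuclideanCLM, ← Matrix.star_eq_conjTranspose,
    map_star, ContinuousLinearMap.star_eq_adjoint, ContinuousLinearMap.adjoint_inner_left]

theorem QState.real_inner_eq (v w : QState ι) : inner ℝ v w = (inner ℂ v w).re := by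
  simp [PiLp.inner_apply, Complex.inner]

/-- Operators whose Hermitian part is negative semidefinite. -/
def dissipative (ι : Type) [Fintype ι] [DecidableEq ι] : AddSubmonoid (QOp ι) where
  carrier := {X | ∀ v : QState ι, (inner ℂ v (X.app v)).re ≤ 0}
  zero_mem' v := by simp [QOp.app_eq_toEuclideanCLM]
  add_mem' {X Y} hX hY v := by
    have : QOp.app (X + Y) v = X.app v + Y.app v := by simp [QOp.app_eq_toEuclideanCLM]
    rw [this, inner_add_right, Complex.add_re]
    exact add_nonpos (hX v) (hY v)

theorem mem_dissipative_of_skew {X : QOp ι} (hX : Xᴴ = -X) : X ∈ dissipative ι := by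
  intro v
  have h := QOp.inner_app X v v
  rw [hX, QOp.neg_app, inner_neg_left, ← inner_conj_symm] at h
  have h2 := congrArg Complex.re h
  simp only [Complex.neg_re, Complex.conj_re] at h2
  have h3 := congrArg Complex.re (inner_conj_symm (𝕜 := ℂ) v (X.app v))
  simp only [Complex.conj_re] at h3
  linarith

theorem neg_conjTranspose_mul_self_mem_dissipative (L : QOp ι) : -(Lᴴ * L) ∈ dissipative ι := by
  intro v
  rw [QOp.neg_app, inner_neg_right, ← QOp.app_app, QOp.inner_app, Matrix.conjTranspose_conjTranspose,
    Complex.neg_re]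
  exact neg_nonpos.2 (inner_self_nonneg (𝕜 := ℂ))

/-- Evaluation at a vector, as a continuous linear map of the operator. -/
noncomputable def appCLM (v : QState ι) : QOp ι →L[ℝ] QState ι :=
  LinearMap.toContinuousLinearMap
    { toFun := fun M => M.app v
      map_add' := fun M N => by simp [QOp.app_eq_toEuclideanCLM]
      map_smul' := fun c M => by
        ext i
        simp [QOp.app, Matrix.smul_mulVec] }

theorem hasDerivAt_exp_app (X : QOp ι) (v : QState ι) (t : ℝ) :
    HasDerivAt (fun u : ℝ => QOp.app (NormedSpace.exp (u • X)) v)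
      (X.app (QOp.app (NormedSpace.exp (t • X)) v)) t := by
  have h := (appCLM v).hasFDerivAt.comp_hasDerivAt t (hasDerivAt_exp_smul_const' (𝕂 := ℝ) X t)
  rw [QOp.app_app]
  exact h

/-- Along `v(u) = exp(uX) v` the derivative of `‖v(u)‖²` is `2 Re ⟨v(u), X v(u)⟩ ≤ 0`. -/
theorem isContractive_of_mem_dissipative {X : QOp ι} (hX : X ∈ dissipative ι) :
    IsContractive X := by
  intro t ht
  refine QOp.norm_le_one fun v => ?_
  have hd : ∀ u : ℝ, HasDerivAt (fun u : ℝ => ‖QOp.app (NormedSpace.exp (u • X)) v‖ ^ 2)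
      (2 * inner ℝ (QOp.app (NormedSpace.exp (u • X)) v)
        (X.app (QOp.app (NormedSpace.exp (u • X)) v))) u := fun u =>
    (hasDerivAt_exp_app X v u).norm_sq
  have hanti : Antitone fun u : ℝ => ‖QOp.app (NormedSpace.exp (u • X)) v‖ ^ 2 := by
    refine antitone_of_deriv_nonpos (fun u => (hd u).differentiableAt) fun u => ?_
    rw [(hd u).deriv, QState.real_inner_eq]
    have := hX (QOp.app (NormedSpace.exp (u • X)) v)
    linarith
  have h := hanti ht
  simp only [zero_smul, NormedSpace.exp_zero, QOp.one_app] at h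
  exact le_of_sq_le_sq h (norm_nonneg _)

/-- The solution of the differential equation is given by the exponential. -/
theorem IsODESolution.eq_exp_app {n : ℕ} {A : QOp (Fin n)} {T : ℝ} (hT : 0 ≤ T)
    {ψ : ℝ → QState (Fin n)} (h : IsODESolution A T ψ) :
    ψ T = QOp.app (NormedSpace.exp (T • A)) (ψ 0) := by
  let A' := Matrix.toEuclideanCLM (𝕜 := ℂ) A
  refine ODE_solution_unique_of_mem_Icc_right (v := fun _ => A') (s := fun _ => Set.univ)
    (K := ‖A'‖₊) (a := 0) (b := T) (fun _ _ => A'.lipschitz.lipschitzOnWith)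
    (fun t ht => (h t ht).continuousWithinAt)
    (fun t ht => ?_) (fun _ _ => Set.mem_univ _)
    (g := fun t => QOp.app (NormedSpace.exp (t • A)) (ψ 0))
    (fun t _ => (hasDerivAt_exp_app A (ψ 0) t).continuousAt.continuousWithinAt)
    (fun t _ => (hasDerivAt_exp_app A (ψ 0) t).hasDerivWithinAt) (fun _ _ => Set.mem_univ _)
    (by simp [QOp.one_app]) ⟨hT, le_rfl⟩
  exact (h t ⟨ht.1, ht.2.le⟩).mono_of_mem_nhdsWithin (Icc_mem_nhdsGE_of_mem ht)

theorem QOp.exp_app_ne_zero (A : QOp ι) {v : QState ι} (hv : v ≠ 0) :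
    QOp.app (NormedSpace.exp A) v ≠ 0 := by
  intro h
  apply hv
  have h1 : NormedSpace.exp (-A) * NormedSpace.exp A = 1 := by
    rw [← Matrix.exp_add_of_commute _ _ (Commute.neg_left (Commute.refl A)), neg_add_cancel,
      NormedSpace.exp_zero]
  rw [← QOp.one_app v, ← h1, ← QOp.app_app, h]
  simp [QOp.app_eq_toEuclideanCLM]

end Dissipative

/-! ### The ancilla, dilation of dissipators, and circuits for single generators. -/

section Ancilla

open scoped Matrix.Norms.L2Operator

variable {n : ℕ}

/-- The isometry `ψ ↦ |b⟩ ⊗ ψ`. -/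
def ancillaEmbed (n : ℕ) (b : Fin 2) : Matrix (Fin (n + 1) → Fin 2) (Fin n → Fin 2) ℂ :=
  Matrix.of fun x y => if x 0 = b ∧ (fun i => x i.succ) = y then 1 else 0

theorem ancillaEmbed_mul_apply {m : Type} (b : Fin 2) (M : Matrix (Fin n → Fin 2) m ℂ)
    (x : Fin (n + 1) → Fin 2) (y : m) :
    (ancillaEmbed n b * M) x y = if x 0 = b then M (fun i => x i.succ) y else 0 := by
  simp only [ancillaEmbed, Matrix.mul_apply, Matrix.of_apply, ite_and, ite_mul, one_mul, zero_mul]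
  split_ifs <;> simp

theorem mul_ancillaEmbed_apply {m : Type} (b : Fin 2) (M : Matrix m (Fin (n + 1) → Fin 2) ℂ)
    (x : m) (y : Fin n → Fin 2) :
    (M * ancillaEmbed n b) x y = M x (Fin.cons b y) := by
  simp only [ancillaEmbed, Matrix.mul_apply, Matrix.of_apply, mul_ite, mul_one, mul_zero]
  rw [Finset.sum_eq_single (Fin.cons b y : Fin (n + 1) → Fin 2)]
  · simp
  · intro z _ hz
    rw [if_neg]
    rintro ⟨h0, h1⟩
    apply hz
    funext i
    refine Fin.cases ?_ (fun j => ?_) i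
    · simpa using h0
    · simpa using congrFun h1 j
  · simp

theorem ancillaEmbed_conjTranspose_mul_self (b : Fin 2) :
    (ancillaEmbed n b)ᴴ * ancillaEmbed n b = 1 := by
  ext x y
  rw [mul_ancillaEmbed_apply, Matrix.conjTranspose_apply, ancillaEmbed, Matrix.of_apply,
    Matrix.one_apply]
  by_cases h : x = y
  · simp [h]
  · simp [h, Ne.symm h]

theorem norm_ancillaEmbed_le (b : Fin 2) : ‖ancillaEmbed n b‖ ≤ 1 := by
  have h := Matrix.l2_opNorm_conjTranspose_mul_self (ancillaEmbed n b)
  rw [ancillaEmbed_conjTranspose_mul_self, norm_one] at h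
  nlinarith [norm_nonneg (ancillaEmbed n b)]

/-- The block of an operator between the ancilla states `|0⟩`. -/
def ancillaBlock (M : QOp (Fin (n + 1))) : QOp (Fin n) :=
  (ancillaEmbed n 0)ᴴ * M * ancillaEmbed n 0

theorem norm_ancillaBlock_le (M : QOp (Fin (n + 1))) : ‖ancillaBlock M‖ ≤ ‖M‖ := by
  have hW := norm_ancillaEmbed_le (n := n) 0
  have h1 : ‖(ancillaEmbed n 0)ᴴ * M‖ ≤ ‖M‖ :=
    (Matrix.l2_opNorm_mul _ _).trans (mul_le_of_le_one_left (norm_nonneg _)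
      ((Matrix.l2_opNorm_conjTranspose _).trans_le hW))
  exact (Matrix.l2_opNorm_mul _ _).trans
    ((mul_le_of_le_one_right (norm_nonneg _) hW).trans h1)

/-- The measurement projects onto the range of `ancillaEmbed n 0`. So any circuit followed by a
measurement applies its ancilla block to the system. -/
theorem measure_op_mul_ancillaEmbed (M : QOp (Fin (n + 1))) :
    (Instr.measure : Instr n).op * M * ancillaEmbed n 0 = ancillaEmbed n 0 * ancillaBlock M := by
  have h : (Instr.measure : Instr n).op = ancillaEmbed n 0 * (ancillaEmbed n 0)ᴴ := by
    ext x y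
    rw [ancillaEmbed_mul_apply, Instr.op, Matrix.diagonal_apply, Matrix.conjTranspose_apply,
      ancillaEmbed, Matrix.of_apply]
    by_cases hx : x 0 = 0
    · by_cases hxy : x = y
      · subst hxy
        simp [hx]
      · rw [if_neg hxy, if_pos hx, if_neg, star_zero]
        rintro ⟨h0, h1⟩
        apply hxy
        funext i
        refine Fin.cases (hx.trans h0.symm) (fun j => ?_) i
        exact (congrFun h1 j).symm
    · simp [hx]
  rw [h, ancillaBlock]
  simp only [Matrix.mul_assoc]

theorem withAncilla_eq (ψ : QState (Fin n)) :
    withAncilla ψ = WithLp.toLp 2 (ancillaEmbed n 0 *ᵥ ψ.ofLp) := by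
  ext x
  simp only [withAncilla, ancillaEmbed, Matrix.mulVec, dotProduct, Matrix.of_apply, ite_and,
    ite_mul, one_mul, zero_mul]
  split_ifs <;> simp

theorem norm_withAncilla (ψ : QState (Fin n)) : ‖withAncilla ψ‖ = ‖ψ‖ := by
  have h : inner ℂ (withAncilla ψ) (withAncilla ψ) = inner ℂ ψ ψ := by
    rw [withAncilla_eq, EuclideanSpace.inner_eq_star_dotProduct,
      EuclideanSpace.inner_eq_star_dotProduct, Matrix.star_mulVec, dotProduct_comm,
      ← Matrix.dotProduct_mulVec, Matrix.mulVec_mulVec, ancillaEmbed_conjTranspose_mul_self,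
      Matrix.one_mulVec, dotProduct_comm]
  rw [inner_self_eq_norm_sq_to_K, inner_self_eq_norm_sq_to_K] at h
  have h2 : ‖withAncilla ψ‖ ^ 2 = ‖ψ‖ ^ 2 := by exact_mod_cast h
  exact (sq_eq_sq₀ (norm_nonneg _) (norm_nonneg _)).1 h2

/-- The circuit applies the operator `V` to the system and leaves the ancilla in `|0⟩`. -/
def Circuit.Implements (c : Circuit n) (V : QOp (Fin n)) : Prop :=
  Circuit.mat c * ancillaEmbed n 0 = ancillaEmbed n 0 * V

theorem Circuit.Implements.run_eq {c : Circuit n} {V : QOp (Fin n)} (h : Circuit.Implements c V)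
    (ψ : QState (Fin n)) : c.run ψ = withAncilla (V.app ψ) := by
  rw [Circuit.run_eq, withAncilla_eq, withAncilla_eq, QOp.app, QOp.app]
  simp only [Matrix.mulVec_mulVec]
  rw [show Circuit.mat c * ancillaEmbed n 0 = ancillaEmbed n 0 * V from h]

theorem Circuit.implements_nil : Circuit.Implements ([] : Circuit n) 1 := by
  simp [Circuit.Implements, Circuit.mat]

theorem Circuit.Implements.append {c d : Circuit n} {V W : QOp (Fin n)}
    (hc : Circuit.Implements c V) (hd : Circuit.Implements d W) :
    Circuit.Implements (c ++ d) (W * V) := by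
  unfold Circuit.Implements at *
  rw [Circuit.mat_append, Matrix.mul_assoc, hc, ← Matrix.mul_assoc, hd, Matrix.mul_assoc]

theorem pauliOp_cons_mul_ancillaEmbed_apply (p : Pauli) (P : Fin n → Pauli) (b : Fin 2)
    (x : Fin (n + 1) → Fin 2) (y : Fin n → Fin 2) :
    (pauliOp (Fin.cons p P : Fin (n + 1) → Pauli) * ancillaEmbed n b) x y =
      p.mat (x 0) b * pauliOp P (fun i => x i.succ) y := by
  rw [mul_ancillaEmbed_apply]
  simp [pauliOp, Fin.prod_univ_succ]

theorem pauliOp_cons_I_mul_ancillaEmbed (P : Fin n → Pauli) :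
    pauliOp (Fin.cons .I P : Fin (n + 1) → Pauli) * ancillaEmbed n 0 =
      ancillaEmbed n 0 * pauliOp P := by
  ext x y
  rw [pauliOp_cons_mul_ancillaEmbed_apply, ancillaEmbed_mul_apply]
  simp [Pauli.mat, Matrix.one_apply]

theorem pauliOp_cons_X_mul_ancillaEmbed (P : Fin n → Pauli) :
    pauliOp (Fin.cons .X P : Fin (n + 1) → Pauli) * ancillaEmbed n 0 =
      ancillaEmbed n 1 * pauliOp P := by
  ext x y
  rw [pauliOp_cons_mul_ancillaEmbed_apply, ancillaEmbed_mul_apply]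
  generalize x 0 = b
  fin_cases b <;> simp [Pauli.mat]

theorem pauliOp_cons_Y_mul_ancillaEmbed (P : Fin n → Pauli) :
    pauliOp (Fin.cons .Y P : Fin (n + 1) → Pauli) * ancillaEmbed n 0 =
      Complex.I • (ancillaEmbed n 1 * pauliOp P) := by
  ext x y
  rw [pauliOp_cons_mul_ancillaEmbed_apply, Matrix.smul_apply, ancillaEmbed_mul_apply]
  generalize x 0 = b
  fin_cases b <;> simp [Pauli.mat]

theorem pauliOp_cons_Z_mul_ancillaEmbed :
    pauliOp (Fin.cons .Z fun _ => .I : Fin (n + 1) → Pauli) * ancillaEmbed n 0 =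
      ancillaEmbed n 0 := by
  ext x y
  rw [pauliOp_cons_mul_ancillaEmbed_apply, ← Matrix.mul_one (ancillaEmbed n 0),
    ancillaEmbed_mul_apply, ← tensorOp_one, pauliOp_eq_tensorOp]
  generalize x 0 = b
  fin_cases b <;> simp [Pauli.mat]

theorem pauliOp_cons_Z_anticommute {p : Pauli} (hp : Pauli.Z.mat * p.mat = -(p.mat * Pauli.Z.mat))
    (P : Fin n → Pauli) :
    pauliOp (Fin.cons .Z fun _ => .I : Fin (n + 1) → Pauli) *
        pauliOp (Fin.cons p P : Fin (n + 1) → Pauli) =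
      -(pauliOp (Fin.cons p P : Fin (n + 1) → Pauli) *
        pauliOp (Fin.cons .Z fun _ => .I : Fin (n + 1) → Pauli)) := by
  simp only [pauliOp_eq_tensorOp, tensorOp_mul]
  rw [← neg_one_smul ℂ]
  ext x y
  simp only [tensorOp, Matrix.of_apply, Matrix.smul_apply, Fin.prod_univ_succ, Fin.cons_zero,
    Fin.cons_succ, hp]
  simp [Pauli.mat]

theorem card_support_cons_le (p : Pauli) (P : Fin n → Pauli) :
    (Finset.univ.filter fun i => (Fin.cons p P : Fin (n + 1) → Pauli) i ≠ .I).card ≤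
      (Finset.univ.filter fun i => P i ≠ .I).card + 1 := by
  have h : (Finset.univ.filter fun i => (Fin.cons p P : Fin (n + 1) → Pauli) i ≠ .I) ⊆
      insert 0 ((Finset.univ.filter fun i => P i ≠ .I).map (Fin.succEmb n)) := by
    intro i
    refine Fin.cases ?_ (fun j => ?_) i <;> simp
  refine (Finset.card_le_card h).trans ((Finset.card_insert_le _ _).trans ?_)
  rw [Finset.card_map]

theorem norm_pauliOp_le {ι : Type} [Fintype ι] [DecidableEq ι] (P : ι → Pauli) :
    ‖pauliOp P‖ ≤ 1 := by
  have h := Matrix.l2_opNorm_conjTranspose_mul_self (pauliOp P)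
  rw [pauliOp_conjTranspose, pauliOp_mul_self, norm_one] at h
  nlinarith [norm_nonneg (pauliOp P)]

theorem norm_axisRot_pauliOp {ι : Type} [Fintype ι] [DecidableEq ι] (P : ι → Pauli) (θ : ℝ) :
    ‖axisRot θ (pauliOp P)‖ = 1 :=
  CStarRing.norm_of_mem_unitary (axisRot_pauliOp_mem_unitary P θ)

theorem TaylorBound.norm_sub_linear_le {𝔸 : Type*} [NormedRing 𝔸] [NormedAlgebra ℂ 𝔸]
    {f : ℝ → 𝔸} {a₀ a₁ a₂ a₃ : 𝔸} {c : ℝ} (hf : TaylorBound f a₀ a₁ a₂ a₃ c) {x : ℝ}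
    (hx : |x| ≤ 1) : ‖f x - (a₀ + (x : ℂ) • a₁)‖ ≤ 3 * c * x ^ 2 := by
  have hc : 0 ≤ c := (norm_nonneg _).trans hf.norm₀
  have e : f x - (a₀ + (x : ℂ) • a₁) =
      (f x - (a₀ + (x : ℂ) • a₁ + (x : ℂ) ^ 2 • a₂ + (x : ℂ) ^ 3 • a₃)) +
        (x : ℂ) ^ 2 • a₂ + (x : ℂ) ^ 3 • a₃ := by abel
  have aux : ∀ k, 2 ≤ k → ∀ r, 0 ≤ r → r ≤ c → |x| ^ k * r ≤ c * x ^ 2 := fun k hk r hr hrc => by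
    rw [mul_comm, ← sq_abs x]
    exact mul_le_mul hrc (pow_le_pow_of_le_one (abs_nonneg _) hx hk) (by positivity) hc
  have h4 := (hf.rem x hx).trans ((mul_comm _ _).trans_le (aux 4 (by norm_num) c hc le_rfl))
  have h2 : ‖(x : ℂ) ^ 2 • a₂‖ ≤ c * x ^ 2 := by
    rw [norm_smul, norm_pow, Complex.norm_real, Real.norm_eq_abs]
    exact aux 2 le_rfl _ (norm_nonneg _) hf.norm₂
  have h3 : ‖(x : ℂ) ^ 3 • a₃‖ ≤ c * x ^ 2 := by
    rw [norm_smul, norm_pow, Complex.norm_real, Real.norm_eq_abs]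
    exact aux 3 (by norm_num) _ (norm_nonneg _) hf.norm₃
  rw [e]
  refine norm_add₃_le.trans ?_
  linarith

/-- One step of the evolution under a single Pauli term of the Hamiltonian. -/
theorem exists_circuit_hamiltonian_term (hn : 1 ≤ n) {w : ℕ} {P : Fin n → Pauli}
    (hP : (Finset.univ.filter fun i => P i ≠ .I).card ≤ w) {s δ : ℝ} (hs : |s| ≤ 1)
    (hδ : 0 ≤ δ) (hδ' : δ ≤ 1) :
    ∃ (c : Circuit n) (V : QOp (Fin n)), Circuit.Implements c V ∧ ‖V‖ ≤ 1 ∧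
      ‖V - (1 + δ • -((Complex.I * s) • pauliOp P))‖ ≤ 3 * δ ^ 2 ∧ c.length ≤ 2 * w + 1 := by
  obtain ⟨c, hc, hl⟩ := exists_circuit_mat_eq_axisRot hn w (δ * s) (Fin.cons .I P)
    ((card_support_cons_le _ _).trans (by omega))
  refine ⟨c, axisRot (δ * s) (pauliOp P), ?_, (norm_axisRot_pauliOp _ _).le, ?_, hl⟩
  · rw [Circuit.Implements, hc]
    simp only [axisRot, Matrix.sub_mul, Matrix.mul_sub, Matrix.smul_mul, Matrix.mul_smul,
      Matrix.one_mul, Matrix.mul_one, pauliOp_cons_I_mul_ancillaEmbed]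
  · have h := (taylorBound_axisRot (norm_one (α := QOp (Fin n))).le (norm_pauliOp_le P)
      hs).norm_sub_linear_le (x := δ) (by rwa [abs_of_nonneg hδ])
    rw [neg_smul, Complex.coe_smul] at h
    simpa using h

/-- The Pauli terms of `L ⊗ |1⟩⟨0| + L† ⊗ |0⟩⟨1|` for `L = ∑ P, c P • P`. -/
def dilationTerms (c : (Fin n → Pauli) → ℂ) (l : List (Fin n → Pauli)) :
    List (ℝ × (Fin (n + 1) → Pauli)) :=
  (l.map fun P => ((c P).re, Fin.cons .X P)) ++ l.map fun P => ((c P).im, Fin.cons .Y P)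

theorem forall_mem_dilationTerms {c : (Fin n → Pauli) → ℂ} {l : List (Fin n → Pauli)}
    {r : ℝ × (Fin (n + 1) → Pauli) → Prop} :
    (∀ q ∈ dilationTerms c l, r q) ↔
      (∀ P ∈ l, r ((c P).re, Fin.cons .X P)) ∧ ∀ P ∈ l, r ((c P).im, Fin.cons .Y P) := by
  rw [dilationTerms, List.forall_mem_append, List.forall_mem_map, List.forall_mem_map]

theorem Pauli.Z_mul_X : Pauli.Z.mat * Pauli.X.mat = -(Pauli.X.mat * Pauli.Z.mat) := by
  ext i j
  fin_cases i <;> fin_cases j <;> simp [Pauli.mat, Matrix.mul_apply, Fin.sum_univ_two]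

theorem Pauli.Z_mul_Y : Pauli.Z.mat * Pauli.Y.mat = -(Pauli.Y.mat * Pauli.Z.mat) := by
  ext i j
  fin_cases i <;> fin_cases j <;> simp [Pauli.mat, Matrix.mul_apply, Fin.sum_univ_two]

/-- Since `X|0⟩ = |1⟩` and `Y|0⟩ = i|1⟩`, the real coefficients of the `X` and `Y` terms recombine
into the complex coefficient of `P`. -/
theorem dilationTerms_sum_mul_ancillaEmbed (c : (Fin n → Pauli) → ℂ) (l : List (Fin n → Pauli)) :
    ((dilationTerms c l).map fun p => (p.1 : ℂ) • pauliOp p.2).sum * ancillaEmbed n 0 =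
      ancillaEmbed n 1 * (l.map fun P => c P • pauliOp P).sum := by
  rw [dilationTerms, List.map_append, List.sum_append, Matrix.add_mul, List.map_map, List.map_map]
  induction l with
  | nil => simp
  | cons P l ih =>
    simp only [List.map_cons, List.sum_cons, Function.comp_apply, Matrix.add_mul, Matrix.mul_add,
      Matrix.smul_mul, Matrix.mul_smul, pauliOp_cons_X_mul_ancillaEmbed,
      pauliOp_cons_Y_mul_ancillaEmbed] at ih ⊢
    rw [← ih]
    have e := Complex.re_add_im (c P)
    conv_rhs => rw [← e]
    module

theorem list_sum_smul_pauliOp_conjTranspose {ι : Type} [Fintype ι] [DecidableEq ι]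
    (l : List (ℝ × (ι → Pauli))) :
    ((l.map fun p => (p.1 : ℂ) • pauliOp p.2).sum)ᴴ =
      (l.map fun p => (p.1 : ℂ) • pauliOp p.2).sum := by
  induction l with
  | nil => simp
  | cons p l ih =>
    rw [List.map_cons, List.sum_cons, Matrix.conjTranspose_add, ih, Matrix.conjTranspose_smul,
      pauliOp_conjTranspose]
    simp

theorem strang_pauliOp_mem_unitary {ι : Type} [Fintype ι] [DecidableEq ι]
    (l : List (ℝ × (ι → Pauli))) (x : ℝ) :
    strang (l.map fun p => (p.1, pauliOp p.2)) x ∈ unitary (QOp ι) := by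
  induction l with
  | nil => exact one_mem _
  | cons p l ih =>
    exact mul_mem (axisRot_pauliOp_mem_unitary _ _)
      (mul_mem ih (axisRot_pauliOp_mem_unitary _ _))

theorem norm_strang_pauliOp {ι : Type} [Fintype ι] [DecidableEq ι]
    (l : List (ℝ × (ι → Pauli))) (x : ℝ) :
    ‖strang (l.map fun p => (p.1, pauliOp p.2)) x‖ = 1 :=
  CStarRing.norm_of_mem_unitary (strang_pauliOp_mem_unitary l x)

theorem forall_mem_map_pauliOp {ι : Type} [Fintype ι] {l : List (ℝ × (ι → Pauli))}
    {r : ℝ × QOp ι → Prop} (h : ∀ p ∈ l, r (p.1, pauliOp p.2)) :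
    ∀ q ∈ l.map fun p => (p.1, pauliOp p.2), r q :=
  List.forall_mem_map.2 h

/-- `Z` on the ancilla fixes `|0⟩`, so it can be inserted on the left, moved through the product at
the price of `x ↦ -x`, and absorbed on the right. -/
theorem ancillaBlock_strang_neg (l : List (ℝ × QOp (Fin (n + 1))))
    (h : ∀ p ∈ l, pauliOp (Fin.cons .Z fun _ => .I : Fin (n + 1) → Pauli) * p.2 =
      -(p.2 * pauliOp (Fin.cons .Z fun _ => .I : Fin (n + 1) → Pauli))) (x : ℝ) :
    ancillaBlock (strang l x) = ancillaBlock (strang l (-x)) := by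
  have hZ := pauliOp_cons_Z_mul_ancillaEmbed (n := n)
  have hZ' := congrArg Matrix.conjTranspose hZ
  rw [Matrix.conjTranspose_mul, pauliOp_conjTranspose] at hZ'
  rw [ancillaBlock, ← hZ', Matrix.mul_assoc _ (pauliOp _) (strang l x),
    mul_strang_of_anticommute l h, ← Matrix.mul_assoc, Matrix.mul_assoc _ (pauliOp _), hZ,
    ancillaBlock]

/-- The ancilla block of the symmetric product formula has no odd terms. -/
theorem norm_ancillaBlock_strang_sub_le (l : List (ℝ × (Fin (n + 1) → Pauli)))
    (hs : ∀ p ∈ l, |p.1| ≤ 1)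
    (h : ∀ p ∈ l, pauliOp (Fin.cons .Z fun _ => .I : Fin (n + 1) → Pauli) * pauliOp p.2 =
      -(pauliOp p.2 * pauliOp (Fin.cons .Z fun _ => .I : Fin (n + 1) → Pauli)))
    {x : ℝ} (hx : |x| ≤ 1) :
    ‖ancillaBlock (strang (l.map fun p => (p.1, pauliOp p.2)) x) -
      (1 - ((x : ℂ) ^ 2 / 2) • ancillaBlock ((l.map fun p => (p.1 : ℂ) • pauliOp p.2).sum *
        (l.map fun p => (p.1 : ℂ) • pauliOp p.2).sum))‖ ≤ 256 ^ l.length * x ^ 4 := by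
  have hev := ancillaBlock_strang_neg (l.map fun p => (p.1, pauliOp p.2))
    (forall_mem_map_pauliOp h) x
  obtain ⟨T, hT⟩ := exists_taylorBound_strang (norm_one (α := QOp (Fin (n + 1)))).le
    (l.map fun p => (p.1, pauliOp p.2)) (forall_mem_map_pauliOp hs)
    (forall_mem_map_pauliOp fun p _ => norm_pauliOp_le p.2)
    (forall_mem_map_pauliOp fun p _ => pauliOp_mul_self p.2)
  rw [List.map_map, List.length_map] at hT
  have r1 := hT.rem x hx
  have r2 := hT.rem (-x) (by rwa [abs_neg])
  rw [abs_neg] at r2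
  have hK : (fun p : ℝ × QOp (Fin (n + 1)) => (p.1 : ℂ) • p.2) ∘
      (fun p : ℝ × (Fin (n + 1) → Pauli) => (p.1, pauliOp p.2)) =
      fun p => (p.1 : ℂ) • pauliOp p.2 := rfl
  rw [hK] at r1 r2
  set K := (l.map fun p => (p.1 : ℂ) • pauliOp p.2).sum
  set S := strang (l.map fun p => (p.1, pauliOp p.2))
  set p1 := (1 : QOp (Fin (n + 1))) + (x : ℂ) • (-Complex.I • K) +
    (x : ℂ) ^ 2 • (-(1 / 2 : ℂ) • (K * K)) + (x : ℂ) ^ 3 • T with hp1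
  set p2 := (1 : QOp (Fin (n + 1))) + ((-x : ℝ) : ℂ) • (-Complex.I • K) +
    ((-x : ℝ) : ℂ) ^ 2 • (-(1 / 2 : ℂ) • (K * K)) + ((-x : ℝ) : ℂ) ^ 3 • T with hp2
  -- The block at `x` equals its average with the block at `-x`; averaging cancels the linear and
  -- cubic terms, including the unknown `T`.
  have hpp : (1 / 2 : ℂ) • (p1 + p2) = 1 - ((x : ℂ) ^ 2 / 2) • (K * K) := by
    rw [hp1, hp2]
    push_cast
    module
  have hlin : ancillaBlock (S x) - (1 - ((x : ℂ) ^ 2 / 2) • ancillaBlock (K * K)) =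
      (1 / 2 : ℂ) • (ancillaBlock (S x - p1) + ancillaBlock (S (-x) - p2)) := by
    have e1 : ancillaBlock (S x) = (1 / 2 : ℂ) • (ancillaBlock (S x) + ancillaBlock (S (-x))) := by
      rw [← hev]; module
    have e2 : 1 - ((x : ℂ) ^ 2 / 2) • ancillaBlock (K * K) =
        (1 / 2 : ℂ) • (ancillaBlock p1 + ancillaBlock p2) := by
      have : ancillaBlock ((1 / 2 : ℂ) • (p1 + p2)) =
          (1 / 2 : ℂ) • (ancillaBlock p1 + ancillaBlock p2) := by
        simp only [ancillaBlock, Matrix.mul_smul, Matrix.smul_mul, Matrix.mul_add, Matrix.add_mul]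
      rw [← this, hpp]
      simp only [ancillaBlock, Matrix.mul_sub, Matrix.sub_mul, Matrix.mul_smul, Matrix.smul_mul,
        Matrix.mul_one, ancillaEmbed_conjTranspose_mul_self]
    rw [e2, e1, ← smul_sub]
    congr 1
    simp only [ancillaBlock, Matrix.mul_sub, Matrix.sub_mul]
    abel
  rw [hlin, norm_smul]
  have b1 := (norm_ancillaBlock_le (S x - p1)).trans r1
  have b2 := (norm_ancillaBlock_le (S (-x) - p2)).trans r2
  have b3 := norm_add_le (ancillaBlock (S x - p1)) (ancillaBlock (S (-x) - p2))
  have e4 : |x| ^ 4 = x ^ 4 := by rw [show 4 = 2 * 2 by norm_num, pow_mul, pow_mul, sq_abs]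
  rw [e4] at b1 b2
  norm_num
  linarith

/-- One step of the evolution under a single dissipator. -/
theorem exists_circuit_dissipator (hn : 1 ≤ n) {w p : ℕ} {c : (Fin n → Pauli) → ℂ}
    (hw : ∀ P, c P ≠ 0 → (Finset.univ.filter fun i => P i ≠ .I).card ≤ w)
    (hp : (Finset.univ.filter fun P => c P ≠ 0).card ≤ p)
    (hre : ∀ P, |(c P).re| ≤ 1) (him : ∀ P, |(c P).im| ≤ 1) {δ : ℝ}
    (hδ : 0 ≤ δ) (hδ' : δ ≤ 1 / 2) :
    ∃ (C : Circuit n) (V : QOp (Fin n)), Circuit.Implements C V ∧ ‖V‖ ≤ 1 ∧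
      ‖V - (1 + δ • -((pauliSum c)ᴴ * pauliSum c))‖ ≤ 4 * 256 ^ (2 * p) * δ ^ 2 ∧
      C.length ≤ 2 * p * (2 * (2 * w + 1)) + 1 := by
  set l := (Finset.univ.filter fun P => c P ≠ 0).toList with hl
  have hlp : l.length ≤ p := by rw [hl, Finset.length_toList]; exact hp
  have hmem : ∀ P ∈ l, c P ≠ 0 := fun P hP => by simpa [hl] using hP
  have hsum : (l.map fun P => c P • pauliOp P).sum = pauliSum c := by
    rw [hl, Finset.sum_map_toList, pauliSum, Finset.sum_filter_of_ne]
    intro P _ h h0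
    exact h (by rw [h0, zero_smul])
  have hlen : (dilationTerms c l).length ≤ 2 * p := by
    simp only [dilationTerms, List.length_append, List.length_map]
    omega
  -- Chosen so that `x²/2 = δ`; then `x⁴ = 4δ²`, and `δ ≤ 1/2` gives `x ≤ 1`.
  set x := Real.sqrt (2 * δ) with hx
  have hx2 : x ^ 2 = 2 * δ := Real.sq_sqrt (by linarith)
  have hx1 : |x| ≤ 1 := by
    rw [abs_of_nonneg (Real.sqrt_nonneg _)]
    exact Real.sqrt_le_one.2 (by linarith)
  obtain ⟨C, hC, hCl⟩ := exists_circuit_mat_eq_strang hn w x (dilationTerms c l)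
    (forall_mem_dilationTerms.2
      ⟨fun P hP => (card_support_cons_le _ _).trans (Nat.succ_le_succ (hw P (hmem P hP))),
        fun P hP => (card_support_cons_le _ _).trans (Nat.succ_le_succ (hw P (hmem P hP)))⟩)
  set S := strang ((dilationTerms c l).map fun p => (p.1, pauliOp p.2)) x with hS
  refine ⟨C ++ [.measure], ancillaBlock S, ?_, ?_, ?_, ?_⟩
  · rw [Circuit.Implements, Circuit.mat_append, Circuit.mat_singleton, hC,
      measure_op_mul_ancillaEmbed]
  · exact (norm_ancillaBlock_le _).trans
      (norm_strang_pauliOp _ x).le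
  · have h := norm_ancillaBlock_strang_sub_le (dilationTerms c l) (forall_mem_dilationTerms.2 ⟨fun P _ => hre P, fun P _ => him P⟩)
      (forall_mem_dilationTerms.2
        ⟨fun P _ => pauliOp_cons_Z_anticommute Pauli.Z_mul_X P,
          fun P _ => pauliOp_cons_Z_anticommute Pauli.Z_mul_Y P⟩) hx1
    -- The dilation is Hermitian and sends `|0⟩ ⊗ φ` to `|1⟩ ⊗ Lφ`, so the block of its square is
    -- `L†L`.
    have hK : ancillaBlock (((dilationTerms c l).map fun p => (p.1 : ℂ) • pauliOp p.2).sum *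
        ((dilationTerms c l).map fun p => (p.1 : ℂ) • pauliOp p.2).sum) =
        (pauliSum c)ᴴ * pauliSum c := by
      have e1 := dilationTerms_sum_mul_ancillaEmbed c l
      have e2 := congrArg Matrix.conjTranspose e1
      rw [Matrix.conjTranspose_mul, list_sum_smul_pauliOp_conjTranspose,
        Matrix.conjTranspose_mul] at e2
      rw [ancillaBlock, ← Matrix.mul_assoc, e2, Matrix.mul_assoc, e1, hsum, Matrix.mul_assoc,
        ← Matrix.mul_assoc _ (ancillaEmbed n 1), ancillaEmbed_conjTranspose_mul_self,
        Matrix.one_mul]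
    rw [hK] at h
    have hx2' : (x : ℂ) ^ 2 / 2 = (δ : ℂ) := by
      have : (x : ℂ) ^ 2 = 2 * δ := by exact_mod_cast hx2
      rw [this]; ring
    rw [hx2', Complex.coe_smul, show x ^ 4 = 4 * δ ^ 2 by
      rw [show x ^ 4 = (x ^ 2) ^ 2 by ring, hx2]; ring] at h
    rw [smul_neg, ← sub_eq_add_neg]
    refine h.trans ?_
    have h256 : (256 : ℝ) ^ (dilationTerms c l).length ≤ 256 ^ (2 * p) :=
      pow_le_pow_right₀ (by norm_num) hlen
    calc (256 : ℝ) ^ (dilationTerms c l).length * (4 * δ ^ 2)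
        ≤ 256 ^ (2 * p) * (4 * δ ^ 2) := by gcongr
      _ = _ := by ring
  · rw [List.length_append, List.length_singleton]
    exact Nat.succ_le_succ (hCl.trans (Nat.mul_le_mul_right _ hlen))

end Ancilla

/-! ### Counting Pauli operators and lattice sites. -/

section Counting

theorem card_pauli : Fintype.card Pauli = 4 := rfl

/-- A Pauli operator supported in `S` is determined by its restriction to `S`. -/
theorem card_pauli_support_subset_le {ι : Type} [Fintype ι] [DecidableEq ι]
    (F : Finset (ι → Pauli)) (S : Finset ι) (h : ∀ P ∈ F, ∀ i, P i ≠ .I → i ∈ S) :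
    F.card ≤ 4 ^ S.card := by
  have h1 : F.card ≤ (Finset.univ : Finset (S → Pauli)).card := by
    refine Finset.card_le_card_of_injOn (fun P i => P i) (fun _ _ => Finset.mem_coe.2 (Finset.mem_univ _)) ?_
    intro P hP Q hQ hPQ
    funext i
    by_cases hi : i ∈ S
    · exact congrFun hPQ ⟨i, hi⟩
    · have hPi : P i = .I := by
        by_contra hh; exact hi (h P hP i hh)
      have hQi : Q i = .I := by
        by_contra hh; exact hi (h Q hQ i hh)
      rw [hPi, hQi]
  refine h1.trans ?_
  rw [Finset.card_univ, Fintype.card_fun, card_pauli, Fintype.card_coe]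

theorem card_box_le {n d : ℕ} {pos : Fin n → Fin d → ℤ} (hpos : Function.Injective pos) (k : ℕ)
    (i : Fin n) :
    (Finset.univ.filter fun j => ∀ a, |pos i a - pos j a| < (k : ℤ)).card ≤ (2 * k) ^ d := by
  have h1 : (Finset.univ.filter fun j => ∀ a, |pos i a - pos j a| < (k : ℤ)).card ≤
      (Fintype.piFinset fun a => Finset.Ioo (pos i a - k) (pos i a + k)).card := by
    refine Finset.card_le_card_of_injOn pos (fun j hj => ?_) hpos.injOn
    simp only [Finset.coe_filter, Finset.mem_univ, true_and, Set.mem_ofPred_eq] at hj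
    rw [Finset.mem_coe, Fintype.mem_piFinset]
    intro a
    have := abs_lt.1 (hj a)
    rw [Finset.mem_Ioo]
    constructor <;> linarith [this.1, this.2]
  refine h1.trans ?_
  rw [Fintype.card_piFinset]
  refine (Finset.prod_le_pow_card _ _ (2 * k) fun a _ => ?_).trans (by simp)
  rw [Int.card_Ioo]
  omega

theorem card_le_of_inCube {n d k : ℕ} {pos : Fin n → Fin d → ℤ} (hpos : Function.Injective pos)
    {S : Finset (Fin n)} (hS : InCube pos k (S : Set (Fin n))) : S.card ≤ (2 * k) ^ d := by
  rcases S.eq_empty_or_nonempty with rfl | ⟨i, hi⟩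
  · simp
  · refine (Finset.card_le_card fun j hj => ?_).trans (card_box_le hpos k i)
    simpa using hS i hi j hj

end Counting

/-! ### Consequences of locality and the circuit for one time step. -/

section Locality

variable {n d J : ℕ} {pos : Fin n → Fin d → ℤ} {k m : ℕ} {h : (Fin n → Pauli) → ℝ}
  {lam : Fin J → (Fin n → Pauli) → ℂ}

/-- The generators of the evolution: the Pauli terms of the Hamiltonian and the dissipators. -/
def generator (h : (Fin n → Pauli) → ℝ) (lam : Fin J → (Fin n → Pauli) → ℂ) :
    {P // h P ≠ 0} ⊕ Fin J → QOp (Fin n)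
  | .inl P => -((Complex.I * h P) • pauliOp P.1)
  | .inr j => -((pauliSum (lam j))ᴴ * pauliSum (lam j))

open Classical in
/-- The qubits on which a generator acts. -/
noncomputable def generatorSupport (h : (Fin n → Pauli) → ℝ)
    (lam : Fin J → (Fin n → Pauli) → ℂ) : {P // h P ≠ 0} ⊕ Fin J → Finset (Fin n)
  | .inl P => Finset.univ.filter fun i => P.1 i ≠ .I
  | .inr j => Finset.univ.filter fun i => i ∈ sumSupport (lam j)

theorem sum_generator [Fintype {P // h P ≠ 0}] : ∑ a, generator h lam a = odeMatrix h lam := by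
  rw [Fintype.sum_sum_type, odeMatrix, sub_eq_add_neg, ← Finset.sum_neg_distrib]
  congr 1
  simp only [generator, Finset.sum_neg_distrib]
  congr 1
  rw [pauliSum, Finset.smul_sum]
  classical
  rw [← Finset.sum_filter_of_ne (p := fun P => h P ≠ 0)]
  · rw [Finset.sum_subtype (p := fun P => h P ≠ 0) (F := inferInstance) _ (by simp)]
    simp only [smul_smul]
  · intro P _ hP h0
    exact hP (by rw [h0]; simp)

theorem pauliSum_conjTranspose {ι : Type} [Fintype ι] [DecidableEq ι] (c : (ι → Pauli) → ℂ) :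
    (pauliSum c)ᴴ = pauliSum fun P => star (c P) := by
  simp [pauliSum, Matrix.conjTranspose_sum, pauliOp_conjTranspose]

theorem pauliSum_commute {ι : Type} [Fintype ι] [DecidableEq ι] {c : (ι → Pauli) → ℂ}
    {M : QOp ι} (hc : ∀ P, c P ≠ 0 → Commute (pauliOp P) M) : Commute (pauliSum c) M := by
  refine Commute.sum_left _ _ _ fun P _ => ?_
  by_cases hP : c P = 0
  · rw [hP, zero_smul]; exact Commute.zero_left M
  · exact (hc P hP).smul_left _

/-- A generator is a polynomial in Pauli operators supported where it acts. Applied once to each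
argument, this reduces commutation of generators to that of Pauli operators. -/
theorem generator_commute_of_pauliOp {a : {P // h P ≠ 0} ⊕ Fin J} {M : QOp (Fin n)}
    (hM : ∀ P : Fin n → Pauli, (∀ i, P i ≠ .I → i ∈ generatorSupport h lam a) →
      Commute (pauliOp P) M) : Commute (generator h lam a) M := by
  rcases a with P | j
  · exact ((hM P.1 fun i hi => by simpa [generatorSupport] using hi).smul_left _).neg_left
  · have hj : ∀ P, lam j P ≠ 0 → Commute (pauliOp P) M := fun P hP =>
      hM P fun i hi => by
        simp only [generatorSupport, Finset.mem_filter, Finset.mem_univ, true_and]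
        exact ⟨P, hP, hi⟩
    refine (Commute.mul_left ?_ (pauliSum_commute hj)).neg_left
    rw [pauliSum_conjTranspose]
    exact pauliSum_commute fun P hP => hj P (star_ne_zero.1 hP)

theorem generator_commute {a b : {P // h P ≠ 0} ⊕ Fin J}
    (hab : Disjoint (generatorSupport h lam a) (generatorSupport h lam b)) :
    Commute (generator h lam a) (generator h lam b) := by
  refine generator_commute_of_pauliOp fun P hP => Commute.symm ?_
  refine generator_commute_of_pauliOp fun Q hQ => pauliOp_commute fun i => ?_
  by_contra! hi
  exact Finset.disjoint_left.1 hab (hP i hi.2) (hQ i hi.1)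

theorem GeometricallyLocal.card_generatorSupport_le (hl : GeometricallyLocal pos k m h lam)
    (a : {P // h P ≠ 0} ⊕ Fin J) : (generatorSupport h lam a).card ≤ (2 * k) ^ d := by
  apply card_le_of_inCube hl.pos_injective
  rcases a with P | j
  · simpa [generatorSupport, pauliSupport] using hl.ham_local P.1 P.2
  · simpa [generatorSupport] using hl.jump_local j

theorem GeometricallyLocal.card_jump_terms_le (hl : GeometricallyLocal pos k m h lam)
    (j : Fin J) : (Finset.univ.filter fun P => lam j P ≠ 0).card ≤ 4 ^ ((2 * k) ^ d) := by
  refine (card_pauli_support_subset_le _ (generatorSupport h lam (.inr j)) ?_).trans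
    (Nat.pow_le_pow_right (by norm_num) (hl.card_generatorSupport_le (.inr j)))
  intro P hP i hi
  simp only [Finset.mem_filter, Finset.mem_univ, true_and] at hP
  simp only [generatorSupport, Finset.mem_filter, Finset.mem_univ, true_and]
  exact ⟨P, hP, hi⟩

/-- A local term acting at `i` is supported in the box around `i`, whose size does not depend on
`n`. -/
theorem GeometricallyLocal.card_ham_terms_at_le (hl : GeometricallyLocal pos k m h lam)
    (i : Fin n) :
    (Finset.univ.filter fun P => h P ≠ 0 ∧ P i ≠ .I).card ≤ 4 ^ ((2 * k) ^ d) := by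
  refine (card_pauli_support_subset_le _ _ ?_).trans
    (Nat.pow_le_pow_right (by norm_num) (card_box_le hl.pos_injective k i))
  intro P hP j hj
  simp only [Finset.mem_filter, Finset.mem_univ, true_and] at hP ⊢
  exact hl.ham_local P hP.1 i hP.2 j hj

theorem GeometricallyLocal.card_generators_at_le [Fintype {P // h P ≠ 0}]
    (hl : GeometricallyLocal pos k m h lam)
    (i : Fin n) : (Finset.univ.filter fun a => i ∈ generatorSupport h lam a).card ≤
      4 ^ ((2 * k) ^ d) + m := by
  classical
  rw [Finset.card_filter, Fintype.sum_sum_type, ← Finset.card_filter, ← Finset.card_filter]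
  refine add_le_add (le_trans ?_ (hl.card_ham_terms_at_le i)) (le_trans ?_ (hl.jump_overlap i))
  · refine Finset.card_le_card_of_injOn Subtype.val (fun P hP => ?_) Subtype.val_injective.injOn
    simp only [Finset.coe_filter, Finset.mem_univ, true_and, Set.mem_ofPred_eq, generatorSupport,
      Finset.mem_filter] at hP ⊢
    exact ⟨P.2, hP⟩
  · rw [← Set.ncard_coe_finset]
    refine Set.ncard_le_ncard (fun j hj => ?_) (Set.toFinite _)
    simpa [generatorSupport] using hj

theorem GeometricallyLocal.card_generators_le [Fintype {P // h P ≠ 0}]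
    (hl : GeometricallyLocal pos k m h lam)
    {κ : ℕ} (hn : 1 ≤ n) (hJ : J ≤ κ * n) :
    Fintype.card ({P // h P ≠ 0} ⊕ Fin J) ≤ n * (4 ^ ((2 * k) ^ d) + 1 + κ) := by
  classical
  have h1 : Fintype.card {P // h P ≠ 0} ≤ n * 4 ^ ((2 * k) ^ d) + 1 := by
    rw [Fintype.card_subtype]
    -- Every term is found at a qubit on which it acts, except the identity, which accounts for the
    -- `+ 1`.
    have hsub : (Finset.univ.filter fun P => h P ≠ 0) ⊆
        (Finset.univ.biUnion fun i => Finset.univ.filter fun P => h P ≠ 0 ∧ P i ≠ .I) ∪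
          {fun _ => .I} := by
      intro P hP
      simp only [Finset.mem_filter, Finset.mem_univ, true_and] at hP
      simp only [Finset.mem_union, Finset.mem_biUnion, Finset.mem_filter, Finset.mem_univ, true_and,
        Finset.mem_singleton]
      by_cases hI : P = fun _ => .I
      · exact Or.inr hI
      · obtain ⟨i, hi⟩ := Function.ne_iff.1 hI
        exact Or.inl ⟨i, hP, hi⟩
    refine (Finset.card_le_card hsub).trans ((Finset.card_union_le _ _).trans ?_)
    rw [Finset.card_singleton]
    refine Nat.succ_le_succ ((Finset.card_biUnion_le_card_mul _ _ _
      fun i _ => hl.card_ham_terms_at_le i).trans ?_)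
    rw [Finset.card_univ, Fintype.card_fin]
  rw [Fintype.card_sum, Fintype.card_fin]
  nlinarith

open scoped Matrix.Norms.L2Operator

theorem GeometricallyLocal.norm_jump_le (hl : GeometricallyLocal pos k m h lam) (j : Fin J) :
    ‖pauliSum (lam j)‖ ≤ 2 * 4 ^ ((2 * k) ^ d) := by
  have h1 : pauliSum (lam j) =
      ∑ P ∈ Finset.univ.filter (fun P => lam j P ≠ 0), lam j P • pauliOp P := by
    rw [Finset.sum_filter_of_ne, pauliSum]
    intro P _ hP h0
    exact hP (by rw [h0, zero_smul])
  rw [h1]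
  refine (norm_sum_le_of_le _ (f := fun P => lam j P • pauliOp P) (n := fun _ => (2 : ℝ))
    fun P _ => ?_).trans ?_
  · rw [norm_smul]
    obtain ⟨hre, him⟩ := hl.jump_coeff j P
    have := Complex.norm_le_abs_re_add_abs_im (lam j P)
    have := abs_le.2 hre
    have := abs_le.2 him
    have := mul_le_of_le_one_right (norm_nonneg (lam j P)) (norm_pauliOp_le P)
    linarith
  · rw [Finset.sum_const, nsmul_eq_mul, mul_comm]
    gcongr
    exact_mod_cast hl.card_jump_terms_le j

theorem GeometricallyLocal.norm_generator_le (hl : GeometricallyLocal pos k m h lam)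
    (a : {P // h P ≠ 0} ⊕ Fin J) :
    ‖generator h lam a‖ ≤ (2 * 4 ^ ((2 * k) ^ d)) ^ 2 := by
  rcases a with P | j
  · have h1 : ‖generator h lam (.inl P)‖ ≤ 1 := by
      rw [generator, norm_neg, norm_smul]
      refine mul_le_one₀ ?_ (norm_nonneg _) (norm_pauliOp_le _)
      simpa using abs_le.2 (hl.ham_coeff P.1)
    refine h1.trans (one_le_pow₀ ?_)
    have : (1 : ℝ) ≤ 4 ^ ((2 * k) ^ d) := one_le_pow₀ (by norm_num)
    linarith
  · rw [generator, norm_neg, Matrix.l2_opNorm_conjTranspose_mul_self, ← sq]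
    have := hl.norm_jump_le j
    gcongr

/-- Only generators meeting the support of `a` contribute: boundedly many qubits, with boundedly
many generators at each. This keeps the Trotter error linear in `n`. -/
theorem GeometricallyLocal.sum_norm_commutator_le [Fintype {P // h P ≠ 0}]
    (hl : GeometricallyLocal pos k m h lam)
    (a : {P // h P ≠ 0} ⊕ Fin J) :
    ∑ c, ‖generator h lam a * generator h lam c - generator h lam c * generator h lam a‖ ≤
      ((2 * k) ^ d * (4 ^ ((2 * k) ^ d) + m) : ℕ) *
        (2 * (2 * 4 ^ ((2 * k) ^ d)) ^ 4) := by
  classical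
  set F := (generatorSupport h lam a).biUnion fun i =>
    Finset.univ.filter fun c => i ∈ generatorSupport h lam c with hF
  have hFc : F.card ≤ (2 * k) ^ d * (4 ^ ((2 * k) ^ d) + m) :=
    (Finset.card_biUnion_le_card_mul _ _ _ fun i _ => hl.card_generators_at_le i).trans
      (Nat.mul_le_mul_right _ (hl.card_generatorSupport_le a))
  rw [← Finset.sum_subset (Finset.subset_univ F)]
  · refine (Finset.sum_le_card_nsmul _ _ (2 * (2 * 4 ^ ((2 * k) ^ d)) ^ 4) fun c _ => ?_).trans ?_
    · refine (norm_sub_le _ _).trans ?_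
      have h1 := norm_mul_le (generator h lam a) (generator h lam c)
      have h2 := norm_mul_le (generator h lam c) (generator h lam a)
      have h3 := mul_le_mul (hl.norm_generator_le a) (hl.norm_generator_le c) (norm_nonneg _)
        (by positivity)
      linarith [mul_comm ‖generator h lam c‖ ‖generator h lam a‖]
    · rw [nsmul_eq_mul]
      gcongr
  · intro c _ hc
    rw [norm_eq_zero, sub_eq_zero]
    refine generator_commute (Finset.disjoint_left.2 fun i hia hic => hc ?_)
    rw [hF, Finset.mem_biUnion]
    exact ⟨i, hia, by simpa using hic⟩

theorem generator_mem_dissipative (a : {P // h P ≠ 0} ⊕ Fin J) :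
    generator h lam a ∈ dissipative (Fin n) := by
  rcases a with P | j
  · refine mem_dissipative_of_skew ?_
    rw [generator, Matrix.conjTranspose_neg, Matrix.conjTranspose_smul, pauliOp_conjTranspose,
      ← neg_smul, ← neg_smul, ← neg_smul]
    simp
  · exact neg_conjTranspose_mul_self_mem_dissipative _

theorem odeMatrix_mem_dissipative (h : (Fin n → Pauli) → ℝ)
    (lam : Fin J → (Fin n → Pauli) → ℂ) : odeMatrix h lam ∈ dissipative (Fin n) := by
  classical
  rw [← sum_generator]
  exact sum_mem fun a _ => generator_mem_dissipative a

/-- One step of the evolution under a single generator. -/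
theorem GeometricallyLocal.exists_circuit_generator (hl : GeometricallyLocal pos k m h lam)
    (hn : 1 ≤ n) {δ : ℝ} (hδ : 0 ≤ δ) (hδ' : δ ≤ 1 / 2) (a : {P // h P ≠ 0} ⊕ Fin J) :
    ∃ (c : Circuit n) (V : QOp (Fin n)), Circuit.Implements c V ∧ ‖V‖ ≤ 1 ∧
      ‖V - (1 + δ • generator h lam a)‖ ≤ 4 * 256 ^ (2 * 4 ^ ((2 * k) ^ d)) * δ ^ 2 ∧
      c.length ≤ 2 * 4 ^ ((2 * k) ^ d) * (2 * (2 * (2 * k) ^ d + 1)) + 1 := by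
  have hs := hl.card_generatorSupport_le a
  rcases a with P | j
  · obtain ⟨c, V, hc, hV, hVG, hlen⟩ := exists_circuit_hamiltonian_term hn (w := (2 * k) ^ d)
      (P := P.1) (by simpa [generatorSupport] using hs) (abs_le.2 (hl.ham_coeff P.1)) hδ
      (by linarith)
    refine ⟨c, V, hc, hV, hVG.trans ?_, hlen.trans ?_⟩
    · have : (1 : ℝ) ≤ 256 ^ (2 * 4 ^ ((2 * k) ^ d)) := one_le_pow₀ (by norm_num)
      gcongr
      linarith
    · have : 1 ≤ 4 ^ ((2 * k) ^ d) := Nat.one_le_pow _ _ (by norm_num)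
      nlinarith
  · refine exists_circuit_dissipator hn (fun P hP => le_trans (Finset.card_le_card ?_) hs)
      (hl.card_jump_terms_le j) (fun P => abs_le.2 (hl.jump_coeff j P).1)
      (fun P => abs_le.2 (hl.jump_coeff j P).2) hδ hδ'
    intro i hi
    simp only [generatorSupport, Finset.mem_filter, Finset.mem_univ, true_and] at hi ⊢
    exact ⟨P, hP, hi⟩

theorem Circuit.exists_implements_list_prod {ι : Type*} {V : ι → QOp (Fin n)} {N : ℕ}
    (hV : ∀ a, ∃ c : Circuit n, Circuit.Implements c (V a) ∧ c.length ≤ N) (l : List ι) :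
    ∃ c : Circuit n, Circuit.Implements c (l.map V).prod ∧ c.length ≤ l.length * N := by
  induction l with
  | nil => exact ⟨[], Circuit.implements_nil, by simp⟩
  | cons a l ih =>
    obtain ⟨c, hc, hcl⟩ := ih
    obtain ⟨e, he, hel⟩ := hV a
    -- The head of the product acts last, so its circuit comes at the end.
    refine ⟨c ++ e, ?_, ?_⟩
    · rw [List.map_cons, List.prod_cons]
      exact hc.append he
    · rw [List.length_append, List.length_cons, add_mul]
      omega

/-- A step of length `δ` of the evolution takes `O(n)` instructions and has an error
`O(n δ ^ 2)`. -/
theorem exists_circuit_step (d k m κ : ℕ) :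
    ∃ (K : ℝ) (N : ℕ), 2 ≤ K ∧ 1 ≤ N ∧
      ∀ (n J : ℕ) (pos : Fin n → Fin d → ℤ) (h : (Fin n → Pauli) → ℝ)
        (lam : Fin J → (Fin n → Pauli) → ℂ), 1 ≤ n → J ≤ κ * n →
        GeometricallyLocal pos k m h lam → ∀ δ : ℝ, 0 ≤ δ → δ ≤ 1 / 2 →
        ∃ (c : Circuit n) (V : QOp (Fin n)), Circuit.Implements c V ∧ ‖V‖ ≤ 1 ∧
          ‖V - NormedSpace.exp (δ • odeMatrix h lam)‖ ≤ n * K * δ ^ 2 ∧ c.length ≤ n * N := by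
  set M : ℕ := 4 ^ ((2 * k) ^ d) + 1 + κ with hM
  set ℓ : ℕ := 2 * 4 ^ ((2 * k) ^ d) * (2 * (2 * (2 * k) ^ d + 1)) + 1 with hℓ
  set b : ℝ := 4 * 256 ^ (2 * 4 ^ ((2 * k) ^ d)) with hb
  set g : ℝ := (2 * 4 ^ ((2 * k) ^ d)) ^ 2 with hg
  set e : ℝ := ((2 * k) ^ d * (4 ^ ((2 * k) ^ d) + m) : ℕ) * (2 * (2 * 4 ^ ((2 * k) ^ d)) ^ 4)
    with he
  have hM1 : 1 ≤ M := (Nat.le_add_left _ _).trans (Nat.le_add_right _ _)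
  have hb2 : 2 ≤ b := by
    have : (1 : ℝ) ≤ 256 ^ (2 * 4 ^ ((2 * k) ^ d)) := one_le_pow₀ (by norm_num)
    linarith
  have he0 : 0 ≤ e := by positivity
  have hs2 : 2 ≤ b + g ^ 2 + e := by nlinarith [sq_nonneg g]
  -- There are at most `n M` generators, each contributing error `(b + g² + e) δ²` and `ℓ`
  -- instructions. The bound `2 ≤ K` serves later to force a step length of at most 1/2.
  refine ⟨M * (b + g ^ 2 + e), M * ℓ, ?_, ?_, ?_⟩
  · have : (1 : ℝ) ≤ M := by exact_mod_cast hM1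
    nlinarith
  · exact Nat.one_le_iff_ne_zero.2 (mul_ne_zero (Nat.one_le_iff_ne_zero.1 hM1) (Nat.succ_ne_zero _))
  intro n J pos h lam hn hJ hl δ hδ hδ'
  classical
  choose C V hC hV hVG hlen using hl.exists_circuit_generator hn hδ hδ'
  set l : List ({P // h P ≠ 0} ⊕ Fin J) := Finset.univ.toList with hlist
  have hcard : l.length ≤ n * M := by
    rw [hlist, Finset.length_toList, Finset.card_univ]
    exact hl.card_generators_le hn hJ
  obtain ⟨c, hc, hcl⟩ := Circuit.exists_implements_list_prod (fun a => ⟨C a, hC a, hlen a⟩) l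
  have herr := norm_list_prod_sub_exp_le (dissipative (Fin n))
    (fun X hX => isContractive_of_mem_dissipative hX) (generator h lam) V
    generator_mem_dissipative hV hδ hVG hl.norm_generator_le hl.sum_norm_commutator_le l
    (Finset.nodup_toList _)
  have hsum : (l.map (generator h lam)).sum = odeMatrix h lam := by
    rw [hlist, Finset.sum_map_toList, sum_generator]
  rw [hsum] at herr
  refine ⟨c, (l.map V).prod, hc, norm_list_prod_le_one V norm_one.le hV l, herr.trans ?_, ?_⟩
  · have : (l.length : ℝ) ≤ n * M := by exact_mod_cast hcard
    calc (l.length : ℝ) * ((b + g ^ 2 + e) * δ ^ 2) ≤ (n * M) * ((b + g ^ 2 + e) * δ ^ 2) := by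
          gcongr
      _ = _ := by ring
  · refine hcl.trans ((Nat.mul_le_mul_right _ hcard).trans ?_)
    rw [mul_assoc]

end Locality

/-! ### Repetition until success, choice of the step number, and the main theorem. -/

section Main

variable {n : ℕ}

theorem Circuit.expectedCost_le {c : Circuit n} {ψ : QState (Fin n)} {p : ℝ} (hp : 0 < p)
    (hp1 : p ≤ 1) (h : p ≤ c.successProb ψ) :
    c.expectedCost ψ ≤ ENNReal.ofReal (p⁻¹ * c.length) := by
  rw [Circuit.expectedCost, ENNReal.tsum_mul_right, ENNReal.tsum_geometric,
    ENNReal.ofReal_mul (inv_nonneg.2 hp.le), ENNReal.ofReal_inv_of_pos hp, ENNReal.ofReal_natCast]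
  gcongr
  have h1 : ENNReal.ofReal p ≤ 1 := ENNReal.ofReal_le_one.2 hp1
  -- Subtraction is truncated: cancellation uses `p ≤ 1`, while monotonicity needs no upper bound on
  -- the success probability.
  calc ENNReal.ofReal p = 1 - (1 - ENNReal.ofReal p) :=
        (ENNReal.sub_sub_cancel ENNReal.one_ne_top h1).symm
    _ ≤ 1 - (1 - ENNReal.ofReal (c.successProb ψ)) := by gcongr

theorem Circuit.exists_implements_pow {c : Circuit n} {V : QOp (Fin n)}
    (h : Circuit.Implements c V) (r : ℕ) :
    ∃ C : Circuit n, Circuit.Implements C (V ^ r) ∧ C.length ≤ r * c.length := by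
  obtain ⟨C, hC, hl⟩ := Circuit.exists_implements_list_prod (V := fun _ : Unit => V)
    (fun _ => ⟨c, h, le_rfl⟩) (List.replicate r ())
  rw [List.map_replicate, List.prod_replicate] at hC
  rw [List.length_replicate] at hl
  exact ⟨C, hC, hl⟩

open scoped Matrix.Norms.L2Operator

theorem norm_exp_smul_odeMatrix_le {J : ℕ} (h : (Fin n → Pauli) → ℝ)
    (lam : Fin J → (Fin n → Pauli) → ℂ) {t : ℝ} (ht : 0 ≤ t) :
    ‖NormedSpace.exp (t • odeMatrix h lam)‖ ≤ 1 :=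
  isContractive_of_mem_dissipative (odeMatrix_mem_dissipative h lam) t ht

theorem norm_pow_sub_exp_le {A V : QOp (Fin n)} (hA : IsContractive A) (hV : ‖V‖ ≤ 1) {T B : ℝ}
    (hT : 0 ≤ T) {r : ℕ} (hr : 0 < r)
    (h : ‖V - NormedSpace.exp ((T / r) • A)‖ ≤ B * (T / r) ^ 2) :
    ‖V ^ r - NormedSpace.exp (T • A)‖ ≤ B * T ^ 2 / r := by
  have hr' : (0 : ℝ) < r := Nat.cast_pos.2 hr
  have e : NormedSpace.exp (T • A) = NormedSpace.exp ((T / r) • A) ^ r := by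
    rw [← Matrix.exp_nsmul, ← Nat.cast_smul_eq_nsmul ℝ, smul_smul, mul_div_cancel₀ _ hr'.ne']
  rw [e]
  refine (norm_pow_sub_pow_le_of_contractions norm_one.le hV
    (hA _ (div_nonneg hT hr'.le)) r).trans ?_
  calc (r : ℝ) * ‖V - NormedSpace.exp ((T / r) • A)‖ ≤ r * (B * (T / r) ^ 2) := by gcongr
    _ = _ := by field_simp

end Main

/-- The normalization is free, so the untouched input may be rescaled to norm at most `(ε - 1)
‖φT‖`, which is within the tolerance. The empty circuit costs nothing. -/
theorem exists_circuit_of_one_lt {n : ℕ} {ε : ℝ} (hε : 1 < ε) (b : ℝ) :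
    ∃ c : Circuit n, ∀ φ φT : QState (Fin n), φT ≠ 0 →
      (∃ (ψt : QState (Fin n)) (r : ℝ), 0 < r ∧ c.run φ = (r : ℂ) • withAncilla ψt ∧
        ‖ψt - φT‖ ≤ ε * ‖φT‖) ∧ c.expectedCost φ ≤ ENNReal.ofReal b := by
  refine ⟨[], fun φ φT hT => ⟨?_, by simp [Circuit.expectedCost]⟩⟩
  have hTpos : 0 < (ε - 1) * ‖φT‖ := mul_pos (by linarith) (norm_pos_iff.2 hT)
  have hnum : 0 < ‖φ‖ + 1 := by positivity
  set r : ℝ := (‖φ‖ + 1) / ((ε - 1) * ‖φT‖) with hr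
  have hr0 : 0 < r := div_pos hnum hTpos
  refine ⟨((r⁻¹ : ℝ) : ℂ) • φ, r, hr0, ?_, ?_⟩
  · ext x
    simp only [Circuit.run, List.foldl_nil, withAncilla, PiLp.smul_apply, smul_eq_mul]
    split_ifs
    · rw [← mul_assoc, ← Complex.ofReal_mul, mul_inv_cancel₀ hr0.ne', Complex.ofReal_one, one_mul]
    · rw [mul_zero]
  · have h1 : ‖((r⁻¹ : ℝ) : ℂ) • φ‖ ≤ (ε - 1) * ‖φT‖ := by
      rw [norm_smul, Complex.norm_real, Real.norm_eq_abs, abs_of_pos (inv_pos.2 hr0), hr, inv_div,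
        div_mul_eq_mul_div, div_le_iff₀ hnum]
      exact mul_le_mul_of_nonneg_left (by linarith) hTpos.le
    linarith [norm_sub_le (((r⁻¹ : ℝ) : ℂ) • φ) φT]

theorem mainTheorem2 (d k m κ : ℕ) :
    ∃ C : ℝ, 0 < C ∧
      ∀ (n J : ℕ) (pos : Fin n → Fin d → ℤ) (h : (Fin n → Pauli) → ℝ)
        (lam : Fin J → (Fin n → Pauli) → ℂ),
        1 ≤ n → J ≤ κ * n → GeometricallyLocal pos k m h lam →
        ∀ T ε q : ℝ, 0 < T → 0 < ε →
          ∃ c : Circuit n, ∀ ψ : ℝ → QState (Fin n),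
            IsODESolution (odeMatrix h lam) T ψ → ψ 0 ≠ 0 → q = ‖ψ 0‖ / ‖ψ T‖ →
              (∃ (ψt : QState (Fin n)) (r : ℝ), 0 < r ∧
                c.run (ψ 0) = (r : ℂ) • withAncilla ψt ∧
                ‖ψt - ψ T‖ ≤ ε * ‖ψ T‖) ∧
              c.expectedCost (ψ 0) ≤
                ENNReal.ofReal (C * (q ^ 3 * n ^ 2 * T ^ 2 / ε + q ^ 2 * n)) := by
  obtain ⟨K, N, hK, hN, hstep⟩ := exists_circuit_step d k m κ
  have hN' : (1 : ℝ) ≤ N := by exact_mod_cast hN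
  refine ⟨8 * N * (K + 1), by positivity, ?_⟩
  intro n J pos h lam hn hJ hl T ε q hT hε
  have hn' : (1 : ℝ) ≤ n := by exact_mod_cast hn
  have hsol : ∀ ψ : ℝ → QState (Fin n), IsODESolution (odeMatrix h lam) T ψ → ψ 0 ≠ 0 →
      ψ T = QOp.app (NormedSpace.exp (T • odeMatrix h lam)) (ψ 0) ∧ ψ T ≠ 0 := by
    intro ψ hψ h0
    have e := hψ.eq_exp_app hT.le
    exact ⟨e, e ▸ QOp.exp_app_ne_zero _ h0⟩
  rcases lt_or_ge 1 ε with hε1 | hε1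
  · obtain ⟨c, hc⟩ := exists_circuit_of_one_lt (n := n) hε1
      (8 * N * (K + 1) * (q ^ 3 * n ^ 2 * T ^ 2 / ε + q ^ 2 * n))
    exact ⟨c, fun ψ hψ h0 _ => hc _ _ (hsol ψ hψ h0).2⟩
  by_cases hq1 : 1 ≤ q
  -- For `q < 1` there is nothing to do: the evolution is a contraction, so no solution has this
  -- ratio.
  swap
  · refine ⟨[], fun ψ hψ h0 hq => absurd ?_ hq1⟩
    obtain ⟨e, hT0⟩ := hsol ψ hψ h0
    rw [hq, one_le_div (norm_pos_iff.2 hT0), e]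
    exact (QOp.norm_app_le _ _).trans (mul_le_of_le_one_left (norm_nonneg _)
      (norm_exp_smul_odeMatrix_le h lam hT.le))
  -- Solves `n K T²/s · q = ε/2`: half the tolerance, leaving the other half for the lower bound on
  -- the output norm.
  set s : ℝ := 2 * K * q * n * T ^ 2 / ε with hs
  have hs0 : 0 ≤ s := by positivity
  set r : ℕ := ⌈s⌉₊ + 1 with hr
  have hr0 : 0 < r := Nat.succ_pos _
  have hr1 : (1 : ℝ) ≤ r := by exact_mod_cast hr0
  have hsr : s ≤ r := (Nat.le_ceil s).trans (by rw [hr]; push_cast; linarith)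
  have hrs : (r : ℝ) ≤ s + 2 := by
    rw [hr]; push_cast
    linarith [Nat.ceil_lt_add_one hs0]
  have hs4 : 4 * T ^ 2 ≤ s := by
    rw [hs, le_div_iff₀ hε]
    have h1 : 2 ≤ K * q := by nlinarith
    have h2 : 2 ≤ K * q * n := by nlinarith
    have h3 : 0 ≤ T ^ 2 := sq_nonneg T
    nlinarith [mul_le_mul_of_nonneg_left hε1 h3, mul_le_mul_of_nonneg_right h2 h3]
  -- From `r ≥ 1` and `r ≥ 4T²` follows `r² ≥ (2T)²`.
  have hδ : T / r ≤ 1 / 2 := by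
    rw [div_le_div_iff₀ (by linarith) two_pos]
    nlinarith
  obtain ⟨c, V, hc, hV, hVe, hcl⟩ := hstep n J pos h lam hn hJ hl (T / r) (by positivity) hδ
  obtain ⟨C, hC, hCl⟩ := Circuit.exists_implements_pow hc r
  have herr := norm_pow_sub_exp_le
    (isContractive_of_mem_dissipative (odeMatrix_mem_dissipative h lam)) hV hT.le hr0 hVe
  refine ⟨C, fun ψ hψ h0 hq => ?_⟩
  obtain ⟨e, hT0⟩ := hsol ψ hψ h0
  have hTpos : 0 < ‖ψ T‖ := norm_pos_iff.2 hT0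
  have h0pos : 0 < ‖ψ 0‖ := norm_pos_iff.2 h0
  have hqn : ‖ψ 0‖ = q * ‖ψ T‖ := by rw [hq, div_mul_cancel₀ _ hTpos.ne']
  have hclose : ‖QOp.app (V ^ r) (ψ 0) - ψ T‖ ≤ ε / 2 * ‖ψ T‖ := by
    rw [e, ← QOp.sub_app, ← e]
    refine (QOp.norm_app_le _ _).trans ?_
    have h1 : n * K * T ^ 2 / r * q ≤ ε / 2 := by
      rw [div_mul_eq_mul_div, div_le_iff₀ (by linarith)]
      rw [hs, div_le_iff₀ hε] at hsr
      linarith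
    calc _ ≤ n * K * T ^ 2 / r * ‖ψ 0‖ := by gcongr
      _ = n * K * T ^ 2 / r * q * ‖ψ T‖ := by rw [hqn]; ring
      _ ≤ _ := by gcongr
  refine ⟨⟨QOp.app (V ^ r) (ψ 0), 1, one_pos, ?_, hclose.trans ?_⟩, ?_⟩
  · rw [hC.run_eq, Complex.ofReal_one, one_smul]
  · gcongr
    linarith
  -- As `ε ≤ 1`, the output keeps at least half of `‖ψ T‖ = ‖ψ 0‖ / q`.
  have hprob : (4 * q ^ 2)⁻¹ ≤ C.successProb (ψ 0) := by
    have h1 : ‖ψ T‖ / 2 ≤ ‖QOp.app (V ^ r) (ψ 0)‖ := by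
      have h2 := norm_sub_norm_le (ψ T) (QOp.app (V ^ r) (ψ 0))
      rw [norm_sub_rev] at h2
      nlinarith
    rw [Circuit.successProb, hC.run_eq, norm_withAncilla, hqn, mul_pow, inv_eq_one_div,
      div_le_div_iff₀ (by positivity) (by positivity)]
    have h3 : (‖ψ T‖ / 2) ^ 2 ≤ ‖QOp.app (V ^ r) (ψ 0)‖ ^ 2 := by gcongr
    nlinarith [mul_le_mul_of_nonneg_right h3 (sq_nonneg q)]
  refine (Circuit.expectedCost_le (by positivity) ?_ hprob).trans (ENNReal.ofReal_le_ofReal ?_)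
  · exact inv_le_one_of_one_le₀ (by nlinarith)
  rw [inv_inv]
  have hlen : (C.length : ℝ) ≤ r * (n * N) := by
    exact_mod_cast hCl.trans (Nat.mul_le_mul_left _ hcl)
  -- The part `s` of the step number yields the `q³n²T²/ε` term; the 2 from rounding yields the
  -- `q²n` term.
  calc 4 * q ^ 2 * (C.length : ℝ) ≤ 4 * q ^ 2 * ((s + 2) * (n * N)) := by
        gcongr
        exact hlen.trans (by gcongr)
    _ = 8 * N * (K * (q ^ 3 * n ^ 2 * T ^ 2 / ε) + q ^ 2 * n) := by rw [hs]; ring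
    _ ≤ 8 * N * (K + 1) * (q ^ 3 * n ^ 2 * T ^ 2 / ε + q ^ 2 * n) := by
        rw [mul_assoc (8 * (N : ℝ))]
        have h1 : 0 ≤ q ^ 3 * n ^ 2 * T ^ 2 / ε := by positivity
        have h2 : 0 ≤ q ^ 2 * n := by positivity
        gcongr
        nlinarith
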